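/- Let $D$ be a finite set of data symbols, let $\Box\notin D$ be the blank, $D_\Box=D\cup\{\Box\}$, and let $\#,\mu,\infty$ be further special symbols. Let $\mathcal A=\{i?x,\ o!x \mid x\in D\cup\{\#\}\}$ be the set of actions, and $\mathcal A_\tau=\mathcal A\cup\{\tau\}$. *Persistent Turing machines.* A persistent Turing machine (PTM) $M$ over $D$ is a nondeterministic Turing machine with finitely many states, tape symbols $D_\Box$, and three semi-infinite tapes: a read-only input tape, a read/write work tape and a write-only output tape (a left move in the leftmost cell leaves the head in place). A configuration from which no step is possible is halted. The content of a tape is the word in $D^*$ at the beginning of the tape, up to the first blank. Consider the computations of $M$ from its initial state, with all heads at the beginning of the tapes and with input, work and output tape containing $w_i$, $w$ and $\varepsilon$, respectively. There is a macrostep $w\xrightarrow{w_i/w_o}w'$ if some such computation reaches a halted configuration in which the contents of the work and output tapes are $w'$ and $w_o$, and there is a macrostep $w\xrightarrow{w_i/\mu}\infty$ if some such computation is infinite. The interactive transition system $\mathcal I(M)$ has as states all elements of $D^*\cup\{\infty\}$ that are reachable from $\varepsilon$ by macrosteps, has initial state $\varepsilon$, and has the macrosteps as transitions. *Encoding.*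 The transition system $\mathcal T(M)$ has states $s_{i,w}$ ($w\in D^*$) and $s_{o,w}$ ($w\in D^*\cup\{\mu\}$) for every state $s$ of $\mathcal I(M)$, initial state $\varepsilon_{i,\varepsilon}$, no final states, and the transitions $$s_{i,w}\xrightarrow{i?d}s_{i,wd},\quad s_{o,dw}\xrightarrow{o!d}s_{o,w},\quad s_{o,\mu}\xrightarrow{\tau}s_{o,\mu},\quad s_{o,\varepsilon}\xrightarrow{o!\#}s_{i,\varepsilon}\qquad(d\in D,\ w\in D^*),$$ and $s_{i,w_i}\xrightarrow{i?\#}s'_{o,w_o}$ whenever $s\xrightarrow{w_i/w_o}s'$ in $\mathcal I(M)$. *Reactive Turing machines.* A reactive Turing machine (RTM) with data symbols $E$ (a finite set not containing $\Box$) consists of a finite set of states, an initial state, a set of final states, and a transition relation whose elements $(s,d,a,e,m,t)$, with $d,e\in E_\Box$, $a\in\mathcal A_\tau$ and $m\in\{L,R\}$, mean: in state $s$, reading $d$, perform $a$, write $e$, move the head one cell in direction $m$, and go to state $t$. Its transition system $\mathcal T(N)$ has as states the configurations (a state, together with a two-way infinite tape that is blank almost everywhere and a head position), with the corresponding $\mathcal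 A_\tau$-labelled transitions. It starts in the initial state with blank tape, and a configuration is final iff its state is. *Branching bisimilarity.* Write $\twoheadrightarrow$ for the reflexive-transitive closure of $\xrightarrow{\tau}$, and $s\xrightarrow{(a)}t$ if $s\xrightarrow{a}t$, or $a=\tau$ and $s=t$. A branching bisimulation between two transition systems is a relation $R$ between their states such that $s_1\,R\,s_2$ implies: (1) if $s_1\xrightarrow{a}s_1'$, then there are $s_2'',s_2'$ with $s_2\twoheadrightarrow s_2''\xrightarrow{(a)}s_2'$, $s_1\,R\,s_2''$ and $s_1'\,R\,s_2'$; (2) if $s_1$ is final, then there is a final $s_2'$ with $s_2\twoheadrightarrow s_2'$ and $s_1\,R\,s_2'$; and symmetrically for transitions and finality of $s_2$. Two transition systems are branching bisimilar, $T_1\leftrightarroweq_{\mathrm b}T_2$, if some branching bisimulation relates their initial states. **Statement.** For every finite set $D$ of data symbols there is a finite set $X$ of auxiliary tape symbols, disjoint from $D\cup\{\Box\}$, such that for every PTM $M$ over $D$ there exists an RTM $N$ with actions $\mathcal A$ and data symbols $D\cup X$ such that $\mathcal T(M)\leftrightarroweq_{\mathrm b}\mathcal T(N)$. -/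

import Mathlib

open Relation

universe u v

/-! ### Labelled transition systems and branching bisimilarity -/

/-- A transition system over the action symbols `A`. Labels are elements of `Option A`;
`none` is the unobservable action `τ`. -/
structure LTS (A : Type u) where
  State : Type v
  step : State → Option A → State → Prop
  start : State
  final : Set State

namespace LTS

variable {A : Type u}

/-- `s` goes to `t` by a single unobservable transition. -/
def tau (T : LTS A) (s t : T.State) : Prop := T.step s none t

/-- `s` goes to `t` by finitely many (possibly zero) unobservable transitions. -/
def taus (T : LTS A) : T.State → T.State → Prop := ReflTransGen T.tau

/-- An optional transition: an `a`-transition, or `a = τ` and the state does not change. -/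
def optStep (T : LTS A) (s : T.State) (a : Option A) (t : T.State) : Prop :=
  T.step s a t ∨ (a = none ∧ s = t)

/-- `R` is a branching bisimulation from `T₁` to `T₂`. -/
structure IsBranchingBisimulation (T₁ : LTS A) (T₂ : LTS A)
    (R : T₁.State → T₂.State → Prop) : Prop where
  step_left : ∀ s₁ s₂, R s₁ s₂ → ∀ a t₁, T₁.step s₁ a t₁ →
    ∃ u₂ t₂, T₂.taus s₂ u₂ ∧ T₂.optStep u₂ a t₂ ∧ R s₁ u₂ ∧ R t₁ t₂
  step_right : ∀ s₁ s₂, R s₁ s₂ → ∀ a t₂, T₂.step s₂ a t₂ →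
    ∃ u₁ t₁, T₁.taus s₁ u₁ ∧ T₁.optStep u₁ a t₁ ∧ R u₁ s₂ ∧ R t₁ t₂
  final_left : ∀ s₁ s₂, R s₁ s₂ → s₁ ∈ T₁.final →
    ∃ t₂, T₂.taus s₂ t₂ ∧ R s₁ t₂ ∧ t₂ ∈ T₂.final
  final_right : ∀ s₁ s₂, R s₁ s₂ → s₂ ∈ T₂.final →
    ∃ t₁, T₁.taus s₁ t₁ ∧ R t₁ s₂ ∧ t₁ ∈ T₁.final

/-- Branching bisimilarity of transition systems. -/
def BranchingBisimilar (T₁ : LTS A) (T₂ : LTS A) : Prop :=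
  ∃ R : T₁.State → T₂.State → Prop, IsBranchingBisimulation T₁ T₂ R ∧ R T₁.start T₂.start

end LTS

/-! ### Reactive Turing machines -/

/-- A reactive Turing machine with action symbols `A` and data symbols `E`. A tape symbol is an
element of `Option E`, where `none` is the blank. `trans s d a e M t` says that in state `s`,
reading `d`, the machine may perform the action `a` (`none` is `τ`), write `e`, move its head
one cell in the direction `M`, and continue in state `t`. -/
structure RTM (A : Type u) (E : Type v) where
  State : Type
  finite_state : Finite State
  start : State
  final : Set State
  trans : State → Option E → Option A → Option E → Turing.Dir → State → Prop

namespace RTM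

variable {A : Type u} {E : Type v}

/-- The transition system of a reactive Turing machine. Its states are the configurations: a
control state with a two-way infinite tape, blank almost everywhere, with a head position.
(`Turing.Tape` identifies tapes up to blanks at the two extremes.) -/
def toLTS (M : RTM A E) : LTS A where
  State := M.State × Turing.Tape (Option E)
  step c a c' := ∃ (e : Option E) (m : Turing.Dir),
    M.trans c.1 c.2.head a e m c'.1 ∧ c'.2 = (c.2.write e).move m
  start := (M.start, default)
  final := {c | c.1 ∈ M.final}

end RTM

/-! ### Interactive transition systems -/

/-- The output component of a macrostep: a word, or `μ` (divergence). -/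
inductive Output (D : Type u) : Type u where
  | word : List D → Output D
  | mu : Output D

/-- An interactive transition system over `D`. `IsDiv` singles out the special divergence state
`∞`, if it is present. No enumerability is imposed on `tr`. -/
structure ITS (D : Type u) where
  State : Type u
  start : State
  IsDiv : State → Prop
  tr : State → List D → Output D → State → Prop
  isDiv_unique : ∀ s t, IsDiv s → IsDiv t → s = t
  reachable : ∀ s, ReflTransGen (fun s t => ∃ wi wo, tr s wi wo t) start s
  tr_to_div : ∀ s wi wo t, tr s wi wo t → IsDiv t → wo = Output.mu
  tr_from_div : ∀ s wi wo t, tr s wi wo t → IsDiv s → IsDiv t ∧ wo = Output.mu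

/-- The symbols that can be communicated: data symbols and the end marker `#`. -/
inductive PortSymbol (D : Type u) : Type u where
  | data : D → PortSymbol D
  | hash : PortSymbol D

/-- The actions `i?x` (receive `x` along the input channel) and `o!x` (send `x` along the output
channel), for `x` a data symbol or `#`. -/
inductive PortAction (D : Type u) : Type u where
  | recv : PortSymbol D → PortAction D
  | send : PortSymbol D → PortAction D

namespace ITS

variable {D : Type u}

/-- The states `s_{i,w}` (input mode) and `s_{o,w}` (output mode) of the encoding. -/
inductive EncState (S : Type u) (D : Type u) : Type u where
  | inp : S → List D → EncState S D
  | out : S → Output D → EncState S D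

/-- The transitions of the encoding of an interactive transition system. -/
inductive EncStep (I : ITS D) :
    EncState I.State D → Option (PortAction D) → EncState I.State D → Prop where
  | recv (s : I.State) (w : List D) (d : D) :
      EncStep I (.inp s w) (some (.recv (.data d))) (.inp s (w ++ [d]))
  | send (s : I.State) (d : D) (w : List D) :
      EncStep I (.out s (.word (d :: w))) (some (.send (.data d))) (.out s (.word w))
  | diverge (s : I.State) :
      EncStep I (.out s .mu) none (.out s .mu)
  | macrostep (s : I.State) (wi : List D) (wo : Output D) (t : I.State) (h : I.tr s wi wo t) :
      EncStep I (.inp s wi) (some (.recv .hash)) (.out t wo)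
  | finish (s : I.State) :
      EncStep I (.out s (.word [])) (some (.send .hash)) (.inp s [])

/-- The transition system encoding an interactive transition system. It starts in input mode in
the initial state with no input received yet, and has no final states. -/
def toLTS (I : ITS D) : LTS (PortAction D) where
  State := EncState I.State D
  step := EncStep I
  start := .inp I.start []
  final := ∅

end ITS

/-! ### Persistent Turing machines -/

/-- Head movements on a semi-infinite tape. -/
inductive HeadMove : Type where
  | left
  | stay
  | right

/-- The new position of the head; in cell `0`, a move to the left leaves the head in place. -/
def HeadMove.apply : HeadMove → ℕ → ℕ
  | .left, n => n - 1
  | .stay, n => n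
  | .right, n => n + 1

/-- A persistent Turing machine with data symbols `D`: a nondeterministic Turing machine with a
read-only input tape, a read/write work tape and a write-only output tape, each semi-infinite.
Tape symbols are elements of `Option D`, where `none` is the blank.

`trans q a b q' b' x mi mw mo` says that in state `q`, reading `a` on the input tape and `b` on
the work tape, the machine may write `b'` on the work tape, write on the output tape the symbol
`y` if `x = some y` (and nothing if `x = none`), move the heads of the input, work and output
tapes according to `mi`, `mw` and `mo`, and continue in state `q'`. -/
structure PTM (D : Type u) where
  State : Type v
  finite_state : Finite State
  start : State
  trans : State → Option D → Option D → State → Option D → Option (Option D) →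
    HeadMove → HeadMove → HeadMove → Prop

namespace PTM

variable {D : Type u}

/-- A semi-infinite tape, with cells numbered from `0`, and its head position. -/
structure HalfTape (D : Type u) where
  cell : ℕ → Option D
  head : ℕ

namespace HalfTape

/-- The tape containing the word `w` followed by blanks, with the head at the beginning. -/
def ofWord (w : List D) : HalfTape D where
  cell n := w[n]?
  head := 0

/-- The symbol under the head. -/
def read (t : HalfTape D) : Option D := t.cell t.head

/-- Write a symbol in the cell under the head. -/
def write (t : HalfTape D) (b : Option D) : HalfTape D where
  cell := Function.update t.cell t.head b
  head := t.head

/-- Move the head. -/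
def move (t : HalfTape D) (m : HeadMove) : HalfTape D where
  cell := t.cell
  head := m.apply t.head

/-- `w` is the content of the tape: the word in `D*` that stands at the beginning of the tape,
up to (and excluding) the first blank cell. -/
def Contains (t : HalfTape D) (w : List D) : Prop :=
  ∀ n ≤ w.length, t.cell n = w[n]?

end HalfTape

/-- Configurations of a persistent Turing machine. -/
structure Config (M : PTM.{u, v} D) where
  state : M.State
  input : HalfTape D
  work : HalfTape D
  output : HalfTape D

/-- The configuration in which a macrostep starts. -/
def startConfig (M : PTM.{u, v} D) (w wi : List D) : M.Config where
  state := M.start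
  input := .ofWord wi
  work := .ofWord w
  output := .ofWord []

/-- A single computation step. -/
def Step (M : PTM.{u, v} D) (c c' : M.Config) : Prop :=
  ∃ (b : Option D) (x : Option (Option D)) (mi mw mo : HeadMove),
    M.trans c.state c.input.read c.work.read c'.state b x mi mw mo ∧
    c'.input = c.input.move mi ∧
    c'.work = (c.work.write b).move mw ∧
    c'.output = (match x with
      | none => c.output
      | some y => c.output.write y).move mo

/-- A configuration is halted if no computation step is possible from it. -/
def Halted (M : PTM.{u, v} D) (c : M.Config) : Prop := ∀ c', ¬ M.Step c c'

/-- A state of the interactive transition system: a word (the content of the work tape), or the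
divergence state `∞`. -/
inductive MacroState (D : Type u) : Type u where
  | word : List D → MacroState D
  | infinity : MacroState D

/-- The macrosteps of a persistent Turing machine. -/
inductive Macrostep (M : PTM.{u, v} D) :
    MacroState D → List D → Output D → MacroState D → Prop where
  /-- Some halting computation leaves `w'` on the work tape and `wo` on the output tape. -/
  | halt (w wi wo w' : List D) (c : M.Config) (hc : ReflTransGen M.Step (M.startConfig w wi) c)
      (hh : M.Halted c) (hw : c.work.Contains w') (ho : c.output.Contains wo) :
      Macrostep M (.word w) wi (.word wo) (.word w')
  /-- Some computation is infinite. -/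
  | diverge (w wi : List D) (c : ℕ → M.Config) (h0 : c 0 = M.startConfig w wi)
      (hs : ∀ n, M.Step (c n) (c (n + 1))) :
      Macrostep M (.word w) wi .mu .infinity

/-- Reachability by macrosteps from the empty word. -/
def Reachable (M : PTM.{u, v} D) (s : MacroState D) : Prop :=
  ReflTransGen (fun s t => ∃ wi wo, M.Macrostep s wi wo t) (.word []) s

/-- The interactive transition system of a persistent Turing machine: its states are the words
(and possibly `∞`) that are reachable by macrosteps from the empty word, and its transitions are
the macrosteps. -/
def toITS (M : PTM.{u, v} D) : ITS D where
  State := {s : MacroState D // M.Reachable s}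
  start := ⟨.word [], ReflTransGen.refl⟩
  IsDiv s := s.1 = .infinity
  tr s wi wo t := M.Macrostep s.1 wi wo t.1
  isDiv_unique s t hs ht := Subtype.ext (hs.trans ht.symm)
  reachable := by
    rintro ⟨s, hs⟩
    induction hs with
    | refl => exact ReflTransGen.refl
    | tail hab hbc ih => exact ReflTransGen.tail ih hbc
  tr_to_div := by
    rintro ⟨s, _⟩ wi wo ⟨t, _⟩ h ht
    cases h with
    | halt => simp at ht
    | diverge => rfl
  tr_from_div := by
    rintro ⟨s, _⟩ wi wo ⟨t, _⟩ h hs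
    cases h <;> simp at hs

/-- The transition system associated with a persistent Turing machine. -/
def toLTS (M : PTM.{u, v} D) : LTS (PortAction D) := M.toITS.toLTS

end PTM

/-! The encoding resolves all the nondeterminism of a macrostep in the single transition `i?#`.
After it the machine must be committed to one outcome, although a configuration offers only finitely
many transitions and there may be infinitely many outcomes. So the choice is prepared beforehand: in
input mode the machine silently increases a number `e`, and when `#` arrives, `e` selects the
outcome through a deterministic computation (`ChoiceStep.outcome`). If `e` codes a halting
computation, its result is returned. Otherwise the computation tree is searched: if it is finite, it
contains a halting computation, and the result of one is returned; if it is infinite, the search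
diverges, which is a legitimate macrostep to `∞` by König's lemma. Conversely, each possible result,
and divergence if some computation is infinite, is selected by arbitrarily large `e`
(`PTM.exists_simulate_of_macrostep`). Hence counting up never excludes a macrostep, and the counting
steps are inert. Endless counting is harmless because branching bisimilarity ignores divergence; for
the same reason the `τ`-loop of the encoding can be matched by a control state without transitions.

This turns the persistent machine into a control program: a finite control whose states run partial
recursive functions, learn one test bit, and then offer actions
(`PTM.isBranchingBisimulation_ctlRel`). As one bit cannot name an output symbol, the program
silently tries candidates until the test succeeds.

Every such program is branching bisimilar to a reactive Turing machine (`CtlProgram.exists_rtm`).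
Datum and test bit are packed into one number, the bit being its lowest digit. A stack machine for
partial recursive functions, compiled to one tape, computes this number and leaves its lowest digit
under the head, where the control can read it. A tape configuration is related to the program state
whose result it is about to compute; this is invariant under the silent moves because they are
deterministic. The tape alphabet is that of the fixed compilation scheme, so the auxiliary symbols
do not depend on the persistent machine. Transitivity of branching bisimilarity joins the pieces. -/

namespace LTS

/-! ### Composition of branching bisimulations. -/

variable {A : Type u}

theorem IsBranchingBisimulation.taus_left {T₁ : LTS A} {T₂ : LTS A}
    {R : T₁.State → T₂.State → Prop} (h : IsBranchingBisimulation T₁ T₂ R) {s t : T₁.State}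
    (st : T₁.taus s t) {s' : T₂.State} (hR : R s s') : ∃ t', T₂.taus s' t' ∧ R t t' := by
  induction st with
  | refl => exact ⟨s', ReflTransGen.refl, hR⟩
  | tail _ hbc ih =>
    obtain ⟨b', hb', hRb⟩ := ih
    obtain ⟨u', c', hu', hopt, _, hRc⟩ := h.step_left _ _ hRb _ _ hbc
    refine ⟨c', ?_, hRc⟩
    rcases hopt with hstep | ⟨_, rfl⟩
    · exact (hb'.trans hu').tail hstep
    · exact hb'.trans hu'

theorem IsBranchingBisimulation.symm {T₁ : LTS A} {T₂ : LTS A}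
    {R : T₁.State → T₂.State → Prop} (h : IsBranchingBisimulation T₁ T₂ R) :
    IsBranchingBisimulation T₂ T₁ (fun s t => R t s) where
  step_left s₁ s₂ hR a t₁ ht := h.step_right s₂ s₁ hR a t₁ ht
  step_right s₁ s₂ hR a t₂ ht := h.step_left s₂ s₁ hR a t₂ ht
  final_left s₁ s₂ hR hf := h.final_right s₂ s₁ hR hf
  final_right s₁ s₂ hR hf := h.final_left s₂ s₁ hR hf

/-- Relational composition works directly because the definition is the semi-branching one: a
`τ`-step may be answered by silent steps to one state that is related to both its source and its
target. No stuttering property is needed. -/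
theorem IsBranchingBisimulation.comp_step {T₁ : LTS A} {T₂ : LTS A} {T₃ : LTS A}
    {R : T₁.State → T₂.State → Prop} {S : T₂.State → T₃.State → Prop}
    (hR : IsBranchingBisimulation T₁ T₂ R) (hS : IsBranchingBisimulation T₂ T₃ S)
    {s₁ : T₁.State} {s₂ : T₂.State} {s₃ : T₃.State} (h₁ : R s₁ s₂) (h₂ : S s₂ s₃)
    {a : Option A} {t₁ : T₁.State} (ht : T₁.step s₁ a t₁) :
    ∃ u₃ t₃, T₃.taus s₃ u₃ ∧ T₃.optStep u₃ a t₃ ∧ (∃ u₂, R s₁ u₂ ∧ S u₂ u₃) ∧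
      ∃ t₂, R t₁ t₂ ∧ S t₂ t₃ := by
  obtain ⟨u₂, t₂, hu, hopt, hRu, hRt⟩ := hR.step_left _ _ h₁ _ _ ht
  obtain ⟨v₃, hv, hSv⟩ := hS.taus_left hu h₂
  rcases hopt with hstep | ⟨rfl, rfl⟩
  · obtain ⟨u₃, t₃, hu₃, hopt₃, hSu, hSt⟩ := hS.step_left _ _ hSv _ _ hstep
    exact ⟨u₃, t₃, hv.trans hu₃, hopt₃, ⟨_, hRu, hSu⟩, _, hRt, hSt⟩
  · exact ⟨v₃, v₃, hv, Or.inr ⟨rfl, rfl⟩, ⟨_, hRu, hSv⟩, _, hRt, hSv⟩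

theorem IsBranchingBisimulation.comp_final {T₁ : LTS A} {T₂ : LTS A} {T₃ : LTS A}
    {R : T₁.State → T₂.State → Prop} {S : T₂.State → T₃.State → Prop}
    (hR : IsBranchingBisimulation T₁ T₂ R) (hS : IsBranchingBisimulation T₂ T₃ S)
    {s₁ : T₁.State} {s₂ : T₂.State} {s₃ : T₃.State} (h₁ : R s₁ s₂) (h₂ : S s₂ s₃)
    (hf : s₁ ∈ T₁.final) : ∃ t₃, T₃.taus s₃ t₃ ∧ (∃ t₂, R s₁ t₂ ∧ S t₂ t₃) ∧ t₃ ∈ T₃.final := by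
  obtain ⟨t₂, ht₂, hRt, hf₂⟩ := hR.final_left _ _ h₁ hf
  obtain ⟨v₃, hv, hSv⟩ := hS.taus_left ht₂ h₂
  obtain ⟨t₃, ht₃, hSt, hf₃⟩ := hS.final_left _ _ hSv hf₂
  exact ⟨t₃, hv.trans ht₃, ⟨_, hRt, hSt⟩, hf₃⟩

theorem BranchingBisimilar.trans {T₁ : LTS A} {T₂ : LTS A} {T₃ : LTS A}
    (h₁ : BranchingBisimilar T₁ T₂) (h₂ : BranchingBisimilar T₂ T₃) :
    BranchingBisimilar T₁ T₃ := by
  obtain ⟨R, hR, hR₀⟩ := h₁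
  obtain ⟨S, hS, hS₀⟩ := h₂
  refine ⟨fun s t => ∃ u, R s u ∧ S u t, ⟨?_, ?_, ?_, ?_⟩, _, hR₀, hS₀⟩
  · rintro s₁ s₃ ⟨s₂, h₁, h₂⟩ a t₁ ht
    exact hR.comp_step hS h₁ h₂ ht
  · rintro s₁ s₃ ⟨s₂, h₁, h₂⟩ a t₃ ht
    obtain ⟨u, t, hu, hopt, ⟨x, hx₁, hx₂⟩, y, hy₁, hy₂⟩ := hS.symm.comp_step hR.symm h₂ h₁ ht
    exact ⟨u, t, hu, hopt, ⟨x, hx₂, hx₁⟩, y, hy₂, hy₁⟩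
  · rintro s₁ s₃ ⟨s₂, h₁, h₂⟩ hf
    exact hR.comp_final hS h₁ h₂ hf
  · rintro s₁ s₃ ⟨s₂, h₁, h₂⟩ hf
    obtain ⟨t, ht, ⟨x, hx₁, hx₂⟩, hft⟩ := hS.symm.comp_final hR.symm h₂ h₁ hf
    exact ⟨t, ht, ⟨x, hx₂, hx₁⟩, hft⟩

/-- A strong bisimulation between transition systems without final states establishes branching
bisimilarity. -/
theorem BranchingBisimilar.of_strong {T₁ : LTS A} {T₂ : LTS A}
    (R : T₁.State → T₂.State → Prop) (h₀ : R T₁.start T₂.start)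
    (hl : ∀ s₁ s₂, R s₁ s₂ → ∀ a t₁, T₁.step s₁ a t₁ → ∃ t₂, T₂.step s₂ a t₂ ∧ R t₁ t₂)
    (hr : ∀ s₁ s₂, R s₁ s₂ → ∀ a t₂, T₂.step s₂ a t₂ → ∃ t₁, T₁.step s₁ a t₁ ∧ R t₁ t₂)
    (hf₁ : T₁.final = ∅) (hf₂ : T₂.final = ∅) : BranchingBisimilar T₁ T₂ := by
  refine ⟨R, ⟨?_, ?_, ?_, ?_⟩, h₀⟩
  · intro s₁ s₂ h a t₁ ht
    obtain ⟨t₂, ht₂, hR⟩ := hl s₁ s₂ h a t₁ ht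
    exact ⟨s₂, t₂, ReflTransGen.refl, Or.inl ht₂, h, hR⟩
  · intro s₁ s₂ h a t₂ ht
    obtain ⟨t₁, ht₁, hR⟩ := hr s₁ s₂ h a t₂ ht
    exact ⟨s₁, t₁, ReflTransGen.refl, Or.inl ht₁, h, hR⟩
  · intro s₁ s₂ _ hf
    simp [hf₁] at hf
  · intro s₁ s₂ _ hf
    simp [hf₂] at hf

end LTS

/-! ### Tape machines with infinite control, and their restriction to reactive Turing machines. -/

open Turing

/-- The transition system of a tape machine whose control is an arbitrary, possibly infinite,
type, over an arbitrary tape alphabet. -/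
def tapeLTS {A : Type*} {Q : Type*} {Γ : Type*} [Inhabited Γ] (q₀ : Q)
    (tr : Q → Γ → Option A → Γ → Dir → Q → Prop) : LTS A where
  State := Q × Tape Γ
  step c a c' := ∃ e m, tr c.1 c.2.head a e m c'.1 ∧ c'.2 = (c.2.write e).move m
  start := (q₀, default)
  final := ∅

theorem tape_map_default {Γ Γ' : Type*} [Inhabited Γ] [Inhabited Γ'] (f : PointedMap Γ Γ') :
    (default : Tape Γ).map f = default := by
  change Tape.mk (f default) (ListBlank.map f (ListBlank.mk [])) (ListBlank.map f (ListBlank.mk []))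
    = Tape.mk default (ListBlank.mk []) (ListBlank.mk [])
  simp

/-- A tape machine that only uses finitely many control states is a reactive Turing machine, over
each alphabet in which its tape symbols can be encoded. -/
theorem exists_rtm_of_tapeLTS {A : Type*} {Q : Type*} {Γ E : Type*} [Inhabited Γ] (q₀ : Q)
    (tr : Q → Γ → Option A → Γ → Dir → Q → Prop) (S : Set Q) (hS : S.Finite) (h₀ : q₀ ∈ S)
    (hcl : ∀ q d a e m q', q ∈ S → tr q d a e m q' → q' ∈ S)
    (i : PointedMap Γ (Option E)) (j : Option E → Γ) (hij : ∀ x, j (i x) = x) :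
    ∃ N : RTM A E, LTS.BranchingBisimilar (tapeLTS q₀ tr) N.toLTS := by
  have := hS.to_subtype
  let e := Finite.equivFin S
  have he (q : Q) (hq : q ∈ S) : q = e.symm (e ⟨q, hq⟩) :=
    (congrArg Subtype.val (e.symm_apply_apply ⟨q, hq⟩)).symm
  let N : RTM A E :=
    { State := Fin (Nat.card S)
      finite_state := inferInstance
      start := e ⟨q₀, h₀⟩
      final := ∅
      trans := fun s d a x m t => ∃ y, x = i y ∧ tr (e.symm s) (j d) a y m (e.symm t) }
  -- Related tapes of `N` are cellwise images under `i`, and `N` writes only such images, so `j`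
  -- recovers every symbol read.
  refine ⟨N, .of_strong (fun c c' => c.1 = e.symm c'.1 ∧ c'.2 = c.2.map i) ?_ ?_ ?_ rfl rfl⟩
  · exact ⟨he q₀ h₀, (tape_map_default i).symm⟩
  · rintro ⟨q, T⟩ ⟨s, T'⟩ ⟨hq, hT⟩ a ⟨q', U⟩ ⟨x, m, h, hU⟩
    dsimp only at hq hT h hU
    subst hq hT hU
    have hq' : q' ∈ S := hcl _ _ _ _ _ _ (e.symm s).2 h
    refine ⟨(e ⟨q', hq'⟩, ((T.write x).move m).map i), ⟨i x, m, ⟨x, rfl, ?_⟩, ?_⟩, he q' hq', rfl⟩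
    · have h' := (he q' hq') ▸ h
      simpa only [Tape.map_fst, hij] using h'
    · simp [Tape.map_move, Tape.map_write]
  · rintro ⟨q, T⟩ ⟨s, T'⟩ ⟨hq, hT⟩ a ⟨t, U⟩ ⟨x, m, ⟨y, hy, h⟩, hU⟩
    dsimp only at hq hT h hU
    subst hq hT hU hy
    refine ⟨(e.symm t, (T.write y).move m), ⟨y, m, ?_, rfl⟩, rfl, ?_⟩
    · simpa [hij] using h
    · simp [Tape.map_move, Tape.map_write]

/-! ### A one-tape evaluator for partial recursive functions. -/

open Turing

namespace Turing.PartrecToTM2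

instance : Finite K' :=
  Finite.of_injective (β := Fin 4)
    (fun k => match k with | .main => 0 | .rev => 1 | .aux => 2 | .stack => 3)
    (by intro a b h; cases a <;> cases b <;> simp_all)

/-- The tape alphabet of the one-tape machine that simulates the four stacks. -/
abbrev TapeSymbol : Type := TM2to1.Γ' K' (fun _ => Γ')

instance : Finite TapeSymbol := inferInstanceAs (Finite (Bool × (K' → Option Γ')))

/-- The one-tape machine, with structured programs, that simulates `tr`. -/
abbrev tr₁ : TM2to1.Λ' K' (fun _ => Γ') Λ' (Option Γ') →
    TM1.Stmt TapeSymbol (TM2to1.Λ' K' (fun _ => Γ') Λ' (Option Γ')) (Option Γ') :=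
  TM2to1.tr tr

/-- The control states of the elementary one-tape machine that simulates `tr`. -/
abbrev State₀ : Type := TM1to0.Λ' tr₁

/-- The elementary one-tape machine that simulates `tr`. -/
abbrev tr₀ : TM0.Machine TapeSymbol State₀ := TM1to0.tr tr₁

/-- The control state in which the one-tape machine starts to execute a label of `tr`. -/
def entry (l : Option Λ') (v : Option Γ') : State₀ :=
  ((l.map TM2to1.Λ'.normal).map tr₁, v)

/-- The tape, with head in the bottom cell, holds the contents of the stacks. -/
def Represents (T : Tape TapeSymbol) (S : K' → List Γ') : Prop :=
  ∃ L : ListBlank (∀ _ : K', Option Γ'),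
    (∀ k, L.map (proj k) = ListBlank.mk ((S k).map some).reverse) ∧
      T = Tape.mk' ∅ (TM2to1.addBottom L)

/-- The symbol in the bottom cell of a stack. -/
theorem Represents.head_snd {T : Tape TapeSymbol} {S : K' → List Γ'} (h : Represents T S)
    (k : K') : T.head.2 k = (S k).getLast? := by
  obtain ⟨L, hL, rfl⟩ := h
  have h₁ : (Tape.mk' ∅ (TM2to1.addBottom L)).head.2 = L.head := by
    have h := TM2to1.addBottom_nth_snd L 0
    rwa [ListBlank.nth_zero, ListBlank.nth_zero] at h
  rw [h₁]
  have h₂ := congrArg ListBlank.head (hL k)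
  rw [ListBlank.head_map, ListBlank.head_mk] at h₂
  change L.head k = _ at h₂
  rw [h₂, ← List.map_reverse, List.getLast?_eq_head?_reverse]
  cases (S k).reverse <;> rfl

/-- The tape symbol in the bottom cell of empty stacks. -/
def bottom : TapeSymbol := (true, fun _ => none)

theorem represents_empty :
    Represents ((default : Tape TapeSymbol).write bottom) (K'.elim [] [] [] []) := by
  refine ⟨∅, ?_, ?_⟩
  · intro k
    cases k <;> rfl
  · rfl

/-- Chains the compilation of stacks to one tape with that of structured programs to elementary
steps. That the final tape is again represented also says that the head is back at the bottom cell.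
-/
theorem exists_mem_eval_tr₀ {l v S T b} (hT : Represents T S)
    (hb : b ∈ StateTransition.eval (TM2.step tr) ⟨some l, v, S⟩) :
    ∃ T', Represents T' b.stk ∧
      (⟨entry b.l b.var, T'⟩ : TM0.Cfg TapeSymbol State₀) ∈
        StateTransition.eval (TM0.step tr₀) ⟨entry (some l) v, T⟩ := by
  obtain ⟨L, hL, rfl⟩ := hT
  obtain ⟨b₁, hb₁, hb₁'⟩ := StateTransition.tr_eval (TM2to1.tr_respects tr) (TM2to1.TrCfg.mk L hL) hb
  obtain ⟨b₂, rfl, hb₂⟩ := StateTransition.tr_eval (TM1to0.tr_respects tr₁) rfl hb₁'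
  cases hb₁ with
  | mk L' hL' => exact ⟨_, ⟨L', hL', rfl⟩, hb₂⟩

theorem eval_tr₀_dom {l v S T} (hT : Represents T S) :
    (StateTransition.eval (TM0.step tr₀)
      (⟨entry (some l) v, T⟩ : TM0.Cfg TapeSymbol State₀)).Dom ↔
      (StateTransition.eval (TM2.step tr) ⟨some l, v, S⟩).Dom := by
  obtain ⟨L, hL, rfl⟩ := hT
  exact (StateTransition.tr_eval_dom (TM1to0.tr_respects tr₁) rfl).trans
    (StateTransition.tr_eval_dom (TM2to1.tr_respects tr) (TM2to1.TrCfg.mk L hL))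

/-- The program that moves the (reversed) data from `rev` back to `main` and evaluates `c`. -/
def launch (c : ToPartrec.Code) : Λ' := .move (fun _ => false) .rev .main (trNormal c .halt)

/-- The program that moves the data from `main` to `rev`, so that its first symbol gets to the
bottom cell. -/
def expose : Λ' := .move (fun _ => false) .main .rev (.ret .halt)

/-- The program that stores the number zero in reverse on `rev` and evaluates `c`. -/
def launchZero (c : ToPartrec.Code) : Λ' := .push .rev (fun _ => some Γ'.cons) (launch c)

theorem eval_launch (c : ToPartrec.Code) (v : List ℕ) (s : Option Γ') :
    StateTransition.eval (TM2.step tr) ⟨some (launch c), s, K'.elim [] (trList v).reverse [] []⟩ =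
      halt <$> c.eval v := by
  rw [← tr_eval]
  -- A stopping predicate that never holds moves the whole stack, which undoes the reversal.
  have h := move_ok (p := fun _ => false) (k₁ := .rev) (k₂ := .main) (q := trNormal c .halt)
    (s := s) (S := K'.elim [] (trList v).reverse [] []) (by decide) (splitAtPred_false _)
  rw [launch, StateTransition.reaches_eval h.to_reflTransGen]
  simp [init]

theorem eval_launchZero (c : ToPartrec.Code) (s : Option Γ') :
    StateTransition.eval (TM2.step tr) ⟨some (launchZero c), s, K'.elim [] [] [] []⟩ =
      halt <$> c.eval [0] := by
  rw [← eval_launch c [0] s]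
  refine StateTransition.reaches_eval (ReflTransGen.single ?_)
  simp [TM2.step, launchZero, TM2.stepAux]

theorem mem_eval_expose (v : List ℕ) (s : Option Γ') :
    (⟨none, none, K'.elim [] (trList v).reverse [] []⟩ : Cfg') ∈
      StateTransition.eval (TM2.step tr) ⟨some expose, s, K'.elim (trList v) [] [] []⟩ := by
  have h := move_ok (p := fun _ => false) (k₁ := .main) (k₂ := .rev) (q := .ret .halt)
    (s := s) (S := K'.elim (trList v) [] [] []) (by decide) (splitAtPred_false _)
  rw [expose, StateTransition.reaches_eval h.to_reflTransGen]
  refine StateTransition.mem_eval.2 ⟨ReflTransGen.single ?_, rfl⟩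
  simp [TM2.step, TM2.stepAux]

/-- Numbers are written with the least significant digit first. Zero has no digits, so there the
first symbol is the separator. -/
theorem head?_trList_singleton (n : ℕ) :
    (trList [n]).head? = some Γ'.bit1 ↔ n.bodd = true := by
  obtain ⟨x, rfl⟩ : ∃ x : Num, (x : ℕ) = n := ⟨n, Num.to_of_nat n⟩
  rw [trList, trNat, Num.of_to_nat]
  cases x with
  | zero => simp [trNum]
  | pos p =>
    cases p <;> simp [trNum, trPosNum, Nat.bodd_add]

/-- Finitely many control states suffice for finitely many programs. -/
theorem exists_finite_closed (P : Set Λ') (hP : P.Finite)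
    (h : ∀ l ∈ P, ∃ S : Finset Λ', l ∈ S ∧ Supports S S) :
    ∃ S₀ : Set State₀, S₀.Finite ∧ (∀ l ∈ P, ∀ v, entry (some l) v ∈ S₀) ∧
      ∀ q a q' s, (q', s) ∈ tr₀ q a → q ∈ S₀ → q' ∈ S₀ := by
  classical
  choose! F hF hF' using h
  have hmono : ∀ {S S' : Finset Λ'} {q : Stmt'}, S ⊆ S' → TM2.SupportsStmt S q →
      TM2.SupportsStmt S' q := by
    intro S S' q hSS' hq
    induction q with
    | branch p q₁ q₂ ih₁ ih₂ => exact ⟨ih₁ hq.1, ih₂ hq.2⟩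
    | goto l => exact fun v => hSS' (hq v)
    | halt => trivial
    | _ => rename_i ih; exact ih hq
  -- `.ret .halt` is added as the default label, which `TM2.Supports` requires to be present.
  let S : Finset Λ' := insert (.ret .halt) (hP.toFinset.biUnion F)
  have hsub (l : Λ') (hl : l ∈ P) : F l ⊆ S := fun x hx =>
    Finset.mem_insert_of_mem (Finset.mem_biUnion.2 ⟨l, hP.mem_toFinset.2 hl, hx⟩)
  have h₂ : TM2.Supports tr S := by
    refine ⟨Finset.mem_insert_self _ _, fun q hq => ?_⟩
    rcases Finset.mem_insert.1 hq with rfl | hq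
    · trivial
    · obtain ⟨l, hl, hq⟩ := Finset.mem_biUnion.1 hq
      rw [hP.mem_toFinset] at hl
      exact hmono (hsub l hl) (hF' l hl q hq)
  have h₁ := TM2to1.tr_supports tr h₂
  have h₀ := TM1to0.tr_supports tr₁ h₁
  refine ⟨_, Finset.finite_toSet _, ?_, fun q a q' s => h₀.2⟩
  intro l hl v
  refine Finset.mem_coe.2 (Finset.mem_product.2 ⟨?_, Finset.mem_univ _⟩)
  refine Finset.some_mem_insertNone.2 (Finset.mem_biUnion.2 ⟨.normal l, ?_, TM1.stmts₁_self⟩)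
  exact Finset.mem_biUnion.2 ⟨l, hsub l hl (hF l hl), Finset.mem_insert_self _ _⟩

theorem exists_supports_launch (c : ToPartrec.Code) :
    ∃ S : Finset Λ', launch c ∈ S ∧ launchZero c ∈ S ∧ Supports S S := by
  refine ⟨insert (launchZero c) (insert (launch c) (codeSupp c .halt)), by simp, by simp, ?_⟩
  have h₁ : trNormal c .halt ∈ codeSupp c .halt := codeSupp_self _ _ (trStmts₁_self _)
  rw [supports_insert, supports_insert]
  refine ⟨?_, ?_, ?_⟩
  · simp [launchZero, TM2.SupportsStmt]
  · simp [launch, TM2.SupportsStmt, h₁]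
  · have h := codeSupp_supports (S := insert (launchZero c) (insert (launch c) (codeSupp c .halt)))
      (c := c) (k := .halt) (fun x hx => by simp [hx])
    exact h

theorem exists_supports_expose : ∃ S : Finset Λ', expose ∈ S ∧ Supports S S := by
  refine ⟨{expose, .ret .halt}, by simp, ?_⟩
  rw [supports_insert, supports_singleton]
  exact ⟨by simp [expose, TM2.SupportsStmt], trivial⟩

end Turing.PartrecToTM2

/-! ### Control programs and their tape machines. -/

open Turing

/-- A control program over data of type `σ`: in the control state `q` the data `x` are
transformed to `y` and a test bit `b` is computed, where `(y, b) ∈ run q x`; then the actions and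
control states in `offer q b` are offered. -/
structure CtlProgram (A : Type*) (Q : Type*) (σ : Type*) where
  run : Q → σ →. σ × Bool
  offer : Q → Bool → Option A → Q → Prop

namespace CtlProgram

/-- The transition system of a control program. -/
def toLTS {A Q σ : Type*} (P : CtlProgram A Q σ) (q₀ : Q) (x₀ : σ) : LTS A where
  State := Q × σ
  step c a c' := ∃ b, (c'.2, b) ∈ P.run c.1 c.2 ∧ P.offer c.1 b a c'.1
  start := (q₀, x₀)
  final := ∅

open PartrecToTM2

section Machine

variable {A Q σ : Type*} (P : CtlProgram A Q σ) (enc : σ → ℕ) (dec : ℕ → σ) (code : Q → ToPartrec.Code) (q₀ : Q)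

/-- The control states of the tape machine: `boot` initializes the tape, `run q ex s` simulates
the elementary machine in state `s` for the control state `q` (executing `launch` if `ex` is
false and `expose` otherwise), and `back` moves the head one cell to the left first. -/
inductive MachineState (Q : Type*) where
  | boot : MachineState Q
  | run (q : Q) (ex : Bool) (s : State₀) : MachineState Q
  | back (q : Q) (ex : Bool) (s : State₀) : MachineState Q

/-- The deterministic internal moves of the tape machine. -/
def internal : MachineState Q → TapeSymbol → Option (TapeSymbol × Dir × MachineState Q)
  | .boot, _ => some (bottom, .right,
      .back q₀ false (entry (some (launchZero (code q₀))) none))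
  | .back q ex s, d => some (d, .left, .run q ex s)
  | .run q ex s, d =>
    match tr₀ s d with
    | some (s', .move m) => some (d, m, .run q ex s')
    | some (s', .write e) => some (e, .right, .back q ex s')
    | none =>
      match ex with
      | false => some (d, .right, .back q true (entry (some expose) none))
      | true => none

/-- The transition relation of the tape machine. -/
inductive MachineStep : MachineState Q → TapeSymbol → Option A → TapeSymbol → Dir →
    MachineState Q → Prop where
  | internal (q d e m q') (h : internal code q₀ q d = some (e, m, q')) :
      MachineStep q d none e m q'
  | offer (q s d a q') (h : internal code q₀ (.run q true s) d = none)
      (ha : P.offer q (d.2 .rev = some Γ'.bit1) a q') :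
      MachineStep (.run q true s) d a d .right
        (.back q' false (entry (some (launch (code q'))) none))

/-- The internal moves of the tape machine on configurations. -/
def machineNext (c : MachineState Q × Tape TapeSymbol) :
    Option (MachineState Q × Tape TapeSymbol) :=
  (internal code q₀ c.1 c.2.head).map fun x => (x.2.2, (c.2.write x.1).move x.2.1)

theorem machineNext_back (q : Q) (ex : Bool) (s : State₀) (T : Tape TapeSymbol) :
    machineNext code q₀ (.back q ex s, T) = some (.run q ex s, T.move .left) := by
  simp [machineNext, internal, Tape.write_self]

theorem reaches_run_of_step (q : Q) (ex : Bool) {c c' : TM0.Cfg TapeSymbol State₀}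
    (h : c' ∈ TM0.step tr₀ c) :
    StateTransition.Reaches (machineNext code q₀) (.run q ex c.q, c.Tape)
      (.run q ex c'.q, c'.Tape) := by
  obtain ⟨s, T⟩ := c
  obtain ⟨⟨s', st⟩, hs, rfl⟩ := Option.map_eq_some_iff.1 h
  cases st with
  | move m =>
    refine ReflTransGen.single ?_
    simp [machineNext, internal, hs, Tape.write_self]
  | write e =>
    refine (ReflTransGen.single (b := (.back q ex s', (T.write e).move .right)) ?_).tail ?_
    · simp [machineNext, internal, hs]
    · rw [machineNext_back]
      simp

theorem reaches_run (q : Q) (ex : Bool) {c c' : TM0.Cfg TapeSymbol State₀}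
    (h : StateTransition.Reaches (TM0.step tr₀) c c') :
    StateTransition.Reaches (machineNext code q₀) (.run q ex c.q, c.Tape)
      (.run q ex c'.q, c'.Tape) := by
  induction h with
  | refl => exact ReflTransGen.refl
  | tail _ h ih => exact ih.trans (reaches_run_of_step code q₀ q ex h)

/-- If the internal moves terminate then so does the simulated elementary machine. -/
theorem eval_dom_of_eval_machineNext {q : Q} {ex : Bool} {s : State₀} {T : Tape TapeSymbol}
    (h : (StateTransition.eval (machineNext code q₀) (.run q ex s, T)).Dom) :
    (StateTransition.eval (TM0.step tr₀) (⟨s, T⟩ : TM0.Cfg TapeSymbol State₀)).Dom := by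
  obtain ⟨b, hb⟩ := Part.dom_iff_mem.1 h
  -- A write costs two moves, since the head has to move at each step. The invariant therefore also
  -- covers the intermediate `back` configurations, which stand for the tape one move to the left.
  let C (c : MachineState Q × Tape TapeSymbol) : Prop :=
    (∀ s, c.1 = .run q ex s →
      (StateTransition.eval (TM0.step tr₀) (⟨s, c.2⟩ : TM0.Cfg TapeSymbol State₀)).Dom) ∧
    (∀ s, c.1 = .back q ex s →
      (StateTransition.eval (TM0.step tr₀)
        (⟨s, c.2.move .left⟩ : TM0.Cfg TapeSymbol State₀)).Dom)
  have hC : C (.run q ex s, T) := by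
    refine StateTransition.evalInduction (C := C) hb ?_
    rintro ⟨c, T⟩ _ ih
    constructor
    · rintro s rfl
      cases hs : tr₀ s T.head with
      | none =>
        have h0 : TM0.step tr₀ (⟨s, T⟩ : TM0.Cfg TapeSymbol State₀) = none := by
          simp [TM0.step, hs]
        exact Part.dom_iff_mem.2 ⟨_, StateTransition.mem_eval.2 ⟨ReflTransGen.refl, h0⟩⟩
      | some x =>
        obtain ⟨s', st⟩ := x
        cases st with
        | move m =>
          have h0 : TM0.step tr₀ (⟨s, T⟩ : TM0.Cfg TapeSymbol State₀) = some ⟨s', T.move m⟩ := by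
            simp [TM0.step, hs]
          rw [StateTransition.reaches_eval (ReflTransGen.single h0)]
          refine (ih (.run q ex s', T.move m) ?_).1 s' rfl
          simp [machineNext, internal, hs, Tape.write_self]
        | write e =>
          have h0 : TM0.step tr₀ (⟨s, T⟩ : TM0.Cfg TapeSymbol State₀) = some ⟨s', T.write e⟩ := by
            simp [TM0.step, hs]
          rw [StateTransition.reaches_eval (ReflTransGen.single h0)]
          have := (ih (.back q ex s', (T.write e).move .right) ?_).2 s' rfl
          · simpa using this
          · simp [machineNext, internal, hs]
    · rintro s rfl
      exact (ih _ (machineNext_back code q₀ q ex s T)).1 s rfl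
  exact hC.1 s rfl

/-- The internal moves end in `c`, where the actions after the computation of `m` are offered. -/
def Ready (q : Q) (m : ℕ) (c : MachineState Q × Tape TapeSymbol) : Prop :=
  ∃ s, c.1 = .run q true s ∧ internal code q₀ c.1 c.2.head = none ∧
    Represents c.2 (K'.elim [] (trList [m]).reverse [] [])

/-- The tape machine computes `m` if `m ∈ f`, and diverges if `f` is undefined. -/
def Computes (q : Q) (f : Part ℕ) (c : MachineState Q × Tape TapeSymbol) : Prop :=
  (∀ m ∈ f, ∃ c' ∈ StateTransition.eval (machineNext code q₀) c, Ready code q₀ q m c') ∧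
    ((StateTransition.eval (machineNext code q₀) c).Dom → f.Dom)

/-- The internal moves are a partial function, so evaluation is the same along them. This makes all
silent steps inert in the bisimulation. -/
theorem Computes.of_reaches {q : Q} {f : Part ℕ} {c c' : MachineState Q × Tape TapeSymbol}
    (h : StateTransition.Reaches (machineNext code q₀) c c') :
    Computes code q₀ q f c ↔ Computes code q₀ q f c' := by
  rw [Computes, Computes, StateTransition.reaches_eval h]

theorem exists_ready {q : Q} {m : ℕ} {T : Tape TapeSymbol}
    (hT : Represents T (K'.elim (trList [m]) [] [] [])) :
    ∃ c' ∈ StateTransition.eval (machineNext code q₀) (.run q true (entry (some expose) none), T),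
      Ready code q₀ q m c' := by
  obtain ⟨T', hT', hmem⟩ := exists_mem_eval_tr₀ hT (mem_eval_expose [m] none)
  have h := reaches_run code q₀ q true (StateTransition.mem_eval.1 hmem).1
  have h0 : internal code q₀ (.run q true (entry none none)) T'.head = none := rfl
  refine ⟨_, StateTransition.mem_eval.2 ⟨h, ?_⟩, _, rfl, h0, hT'⟩
  simp only [machineNext, h0, Option.map_none]

/-- The evaluator runs first, and when it halts `expose` brings the lowest digit to the bottom cell.
Divergence can come only from the evaluator, so termination of the internal moves implies that `f`
is defined. -/
theorem computes_of_eval {q : Q} {f : Part ℕ} {l : Λ'} {S : K' → List Γ'} {T : Tape TapeSymbol}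
    (hl : StateTransition.eval (TM2.step tr) ⟨some l, none, S⟩ = f.map fun m => halt [m])
    (hT : Represents T S) : Computes code q₀ q f (.run q false (entry (some l) none), T) := by
  constructor
  · intro m hm
    have hm' : halt [m] ∈ StateTransition.eval (TM2.step tr) ⟨some l, none, S⟩ := by
      rw [hl]
      exact Part.mem_map _ hm
    obtain ⟨T', hT', hmem⟩ := exists_mem_eval_tr₀ hT hm'
    have h := reaches_run code q₀ q false (StateTransition.mem_eval.1 hmem).1
    have h' : StateTransition.Reaches (machineNext code q₀)
        (.run q false (entry none none), T') (.run q true (entry (some expose) none), T') := by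
      refine (ReflTransGen.single
        (b := (.back q true (entry (some expose) none), T'.move .right)) ?_).tail ?_
      · have h0 : internal code q₀ (.run q false (entry none none)) T'.head =
          some (T'.head, .right, .back q true (entry (some expose) none)) := rfl
        simp [machineNext, h0, Tape.write_self]
      · rw [machineNext_back]
        simp
    rw [StateTransition.reaches_eval (h.trans h')]
    exact exists_ready code q₀ hT'
  · intro hd
    have h₁ := eval_dom_of_eval_machineNext code q₀ hd
    rw [eval_tr₀_dom hT, hl] at h₁
    exact h₁

variable {enc dec code} in
theorem computes_launch (hcode : ∀ q n, (code q).eval [n] = ((P.run q (dec n)).map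
      fun x => [Nat.bit x.2 (enc x.1)])) {q : Q} {n : ℕ} {T : Tape TapeSymbol}
    (hT : Represents T (K'.elim [] (trList [n]).reverse [] [])) :
    Computes code q₀ q ((P.run q (dec n)).map fun x => Nat.bit x.2 (enc x.1))
      (.back q false (entry (some (launch (code q))) none), T.move .right) := by
  rw [Computes.of_reaches code q₀ (ReflTransGen.single (machineNext_back code q₀ _ _ _ _)),
    Tape.move_right_left]
  refine computes_of_eval code q₀ ?_ hT
  rw [eval_launch, hcode, Part.map_eq_map, Part.map_map, Part.map_map]
  rfl

variable {enc dec code} in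
theorem computes_boot (hcode : ∀ q n, (code q).eval [n] = ((P.run q (dec n)).map
      fun x => [Nat.bit x.2 (enc x.1)])) :
    Computes code q₀ q₀ ((P.run q₀ (dec 0)).map fun x => Nat.bit x.2 (enc x.1)) (.boot, default) := by
  have h : StateTransition.Reaches (machineNext code q₀) (.boot, default)
      (.run q₀ false (entry (some (launchZero (code q₀))) none),
        (default : Tape TapeSymbol).write bottom) := by
    have h₁ : machineNext code q₀ (.boot, default) =
        some (.back q₀ false (entry (some (launchZero (code q₀))) none),
          ((default : Tape TapeSymbol).write bottom).move .right) := rfl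
    refine ReflTransGen.head h₁ (ReflTransGen.single ?_)
    rw [machineNext_back, Tape.move_right_left]
    rfl
  rw [Computes.of_reaches code q₀ h]
  refine computes_of_eval code q₀ ?_ represents_empty
  rw [eval_launchZero, hcode, Part.map_eq_map, Part.map_map, Part.map_map]
  rfl

variable {enc dec code} in
-- A program state is related to every configuration that computes its pending result. The test bit
-- is never erased: by `hd` the next computation simply ignores the lowest digit, so an offered
-- action leaves the tape contents as they are.
theorem branchingBisimilar_machine (x₀ : σ) (hd : ∀ b y, dec (Nat.bit b (enc y)) = y)
    (hd₀ : dec 0 = x₀)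
    (hcode : ∀ q n, (code q).eval [n] = ((P.run q (dec n)).map
      fun x => [Nat.bit x.2 (enc x.1)])) :
    LTS.BranchingBisimilar (P.toLTS q₀ x₀) (tapeLTS .boot (MachineStep P code q₀)) := by
  let next := machineNext code q₀
  let N : LTS A := tapeLTS .boot (MachineStep P code q₀)
  have hnext {c c'} (h : c' ∈ next c) : N.step c none c' := by
    obtain ⟨⟨e, m, q'⟩, hi, rfl⟩ := Option.map_eq_some_iff.1 h
    exact ⟨e, m, .internal _ _ _ _ _ hi, rfl⟩
  have htaus {c c'} (h : StateTransition.Reaches next c c') : N.taus c c' :=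
    ReflTransGen.mono (fun _ _ h => hnext h) _ _ h
  have hbit (m : ℕ) (T : Tape TapeSymbol)
      (hT : Represents T (K'.elim [] (trList [m]).reverse [] [])) :
      decide (T.head.2 .rev = some Γ'.bit1) = m.bodd := by
    rw [hT.head_snd, K'.elim_rev, List.getLast?_reverse, Bool.eq_iff_iff, decide_eq_true_iff,
      head?_trList_singleton]
  let R (s : Q × σ) (c : MachineState Q × Tape TapeSymbol) : Prop :=
    Computes code q₀ s.1 ((P.run s.1 s.2).map fun x => Nat.bit x.2 (enc x.1)) c
  have hR {q' y b T} (hT : Represents T (K'.elim [] (trList [Nat.bit b (enc y)]).reverse [] [])) :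
      R (q', y) (.back q' false (entry (some (launch (code q'))) none), T.move .right) := by
    have h := computes_launch P q₀ hcode (q := q') hT
    rwa [hd] at h
  refine ⟨R, ⟨?_, ?_, ?_, ?_⟩, ?_⟩
  · rintro ⟨q, x⟩ c h a ⟨q', y⟩ ⟨b, hy, ha⟩
    obtain ⟨⟨c₁, T⟩, hc', s, rfl, hs, hT⟩ := h.1 _ (Part.mem_map _ hy)
    have hreach := (StateTransition.mem_eval.1 hc').1
    refine ⟨_, (.back q' false (entry (some (launch (code q'))) none), T.move .right),
      htaus hreach, Or.inl ⟨T.head, .right, ?_, ?_⟩, (Computes.of_reaches code q₀ hreach).1 h,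
      hR hT⟩
    · refine .offer q s T.head a q' hs ?_
      rw [hbit _ T hT, Nat.bodd_bit]
      exact ha
    · rw [Tape.write_self]
  · rintro ⟨q, x⟩ ⟨c, T⟩ h a ⟨c', T'⟩ ⟨e, m, hstep, hT'⟩
    dsimp only at hstep hT'
    subst hT'
    cases hstep with
    | internal _ _ _ _ _ hi =>
      refine ⟨(q, x), (q, x), ReflTransGen.refl, Or.inr ⟨rfl, rfl⟩, h, ?_⟩
      refine (Computes.of_reaches code q₀ (ReflTransGen.single ?_)).1 h
      simp [machineNext, hi]
    | offer q₁ s _ _ q' hi ha =>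
      -- An offer occurs only where internal moves have stopped, so this configuration is its own
      -- final one. Uniqueness of the final configuration identifies it with the `Ready` one.
      have hmem : (.run q₁ true s, T) ∈ StateTransition.eval next (.run q₁ true s, T) := by
        refine StateTransition.mem_eval.2 ⟨ReflTransGen.refl, ?_⟩
        simp [next, machineNext, hi]
      have hdom := h.2 (Part.dom_iff_mem.2 ⟨_, hmem⟩)
      obtain ⟨m, hm⟩ := Part.dom_iff_mem.1 hdom
      obtain ⟨⟨y, b⟩, hy, rfl⟩ := (Part.mem_map_iff _).1 hm
      obtain ⟨c', hc', s', hs', _, hT⟩ := h.1 _ hm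
      obtain rfl := Part.mem_unique hmem hc'
      cases hs'
      rw [hbit _ T hT, Nat.bodd_bit] at ha
      refine ⟨(q, x), (q', y), ReflTransGen.refl, Or.inl ⟨b, hy, ha⟩, h, ?_⟩
      rw [Tape.write_self]
      exact hR hT
  · rintro _ _ _ ⟨⟩
  · rintro _ _ _ ⟨⟩
  · change Computes _ _ _ _ _
    have h := computes_boot P q₀ hcode
    rwa [hd₀] at h

/-- Only the programs `launch (code q)`, `launchZero (code q)` and `expose` are ever entered. They
are finitely many, and each needs finitely many elementary states. -/
theorem exists_rtm_machine {E : Type*} [Finite Q] (i : PointedMap TapeSymbol (Option E))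
    (j : Option E → TapeSymbol) (hij : ∀ x, j (i x) = x) :
    ∃ N : RTM A E,
      LTS.BranchingBisimilar (tapeLTS .boot (MachineStep P code q₀)) N.toLTS := by
  let L : Set Λ' := Set.range (fun q => launch (code q)) ∪
    Set.range (fun q => launchZero (code q)) ∪ {expose}
  have hL : L.Finite :=
    ((Set.finite_range _).union (Set.finite_range _)).union (Set.finite_singleton _)
  obtain ⟨S, hS, hentry, hcl⟩ := exists_finite_closed L hL (by
    rintro _ ((⟨q, rfl⟩ | ⟨q, rfl⟩) | rfl)
    · obtain ⟨S, h₁, _, h⟩ := exists_supports_launch (code q)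
      exact ⟨S, h₁, h⟩
    · obtain ⟨S, _, h₂, h⟩ := exists_supports_launch (code q)
      exact ⟨S, h₂, h⟩
    · exact exists_supports_expose)
  let f (back : Bool) (x : Q × Bool × State₀) : MachineState Q :=
    cond back (.back x.1 x.2.1 x.2.2) (.run x.1 x.2.1 x.2.2)
  let D : Set (Q × Bool × State₀) := Set.univ ×ˢ Set.univ ×ˢ S
  have hD : D.Finite := Set.finite_univ.prod (Set.finite_univ.prod hS)
  have hmem {b q ex s} (hs : s ∈ S) : f b (q, ex, s) ∈ f b '' D :=
    Set.mem_image_of_mem _ ⟨trivial, trivial, hs⟩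
  refine exists_rtm_of_tapeLTS .boot _ ({.boot} ∪ f true '' D ∪ f false '' D)
    (((Set.finite_singleton _).union (hD.image _)).union (hD.image _)) (by simp) ?_ i j hij
  have hS' {ex q s} (h : (.run q ex s : MachineState Q) ∈ {.boot} ∪ f true '' D ∪ f false '' D) :
      s ∈ S := by
    rcases h with (h | ⟨x, _, h⟩) | ⟨x, hx, h⟩
    · cases h
    · cases h
    · cases h
      exact hx.2.2
  have hS'' {ex q s} (h : (.back q ex s : MachineState Q) ∈ {.boot} ∪ f true '' D ∪ f false '' D) :
      s ∈ S := by
    rcases h with (h | ⟨x, hx, h⟩) | ⟨x, _, h⟩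
    · cases h
    · cases h
      exact hx.2.2
    · cases h
  intro c d a e m c' hc h
  cases h with
  | internal _ _ _ _ _ h =>
    cases c with
    | boot =>
      cases h
      exact Or.inl (Or.inr (hmem (b := true) (hentry _ (Or.inl (Or.inr ⟨q₀, rfl⟩)) _)))
    | back q ex s =>
      cases h
      exact Or.inr (hmem (b := false) (hS'' hc))
    | run q ex s =>
      cases hs : tr₀ s d with
      | none =>
        cases ex with
        | false =>
          simp only [internal, hs, Option.some.injEq, Prod.mk.injEq] at h
          obtain ⟨_, _, rfl⟩ := h
          exact Or.inl (Or.inr (hmem (b := true) (hentry _ (Or.inr rfl) _)))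
        | true => simp [internal, hs] at h
      | some x =>
        obtain ⟨s', st⟩ := x
        have hs' := hcl _ _ _ _ hs (hS' hc)
        cases st with
        | move m =>
          simp only [internal, hs, Option.some.injEq, Prod.mk.injEq] at h
          obtain ⟨_, _, rfl⟩ := h
          exact Or.inr (hmem (b := false) hs')
        | write e =>
          simp only [internal, hs, Option.some.injEq, Prod.mk.injEq] at h
          obtain ⟨_, _, rfl⟩ := h
          exact Or.inl (Or.inr (hmem (b := true) hs'))
  | offer q s _ _ q' h ha =>
    exact Or.inl (Or.inr (hmem (b := true) (hentry _ (Or.inl (Or.inl ⟨q', rfl⟩)) _)))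

end Machine

/-- Every control program with finitely many control states and partial recursive computations is
branching bisimilar to a reactive Turing machine. -/
theorem exists_rtm {A Q σ : Type*} {E : Type*} [Finite Q] [Primcodable σ]
    (P : CtlProgram A Q σ) (hP : ∀ q, Partrec (P.run q)) (q₀ : Q) (x₀ : σ)
    (hx₀ : Encodable.encode x₀ = 0)
    (i : PointedMap TapeSymbol (Option E)) (j : Option E → TapeSymbol) (hij : ∀ x, j (i x) = x) :
    ∃ N : RTM A E, LTS.BranchingBisimilar (P.toLTS q₀ x₀) N.toLTS := by
  -- Halving drops the test bit. The default is irrelevant on the numbers that occur.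
  let dec (n : ℕ) : σ := (Encodable.decode n.div2).getD x₀
  have hdec : Computable dec := Computable.option_getD
    ((Computable.decode (α := σ)).comp Primrec.nat_div2.to_comp) (Computable.const x₀)
  have hcode (q : Q) : ∃ c : ToPartrec.Code, ∀ n, c.eval [n] =
      ((P.run q (dec n)).map fun x => [Nat.bit x.2 (Encodable.encode x.1)]) := by
    have h₁ : Partrec fun n =>
        (P.run q (dec n)).map fun x => Nat.bit x.2 (Encodable.encode x.1) := by
      have h₂ : Computable fun x : ℕ × σ × Bool => cond x.2.2 (2 * Encodable.encode x.2.1 + 1)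
          (2 * Encodable.encode x.2.1) := by
        have h₃ : Computable fun x : ℕ × σ × Bool => 2 * Encodable.encode x.2.1 :=
          Primrec.nat_double.to_comp.comp (Computable.encode.comp
            (Computable.fst.comp Computable.snd))
        exact Computable.cond (Computable.snd.comp Computable.snd) (Computable.succ.comp h₃) h₃
      have h₄ : Computable₂ fun (_ : ℕ) (x : σ × Bool) => Nat.bit x.2 (Encodable.encode x.1) :=
        h₂.of_eq fun x => by rcases x with ⟨_, _, b⟩; cases b <;> rfl
      exact ((hP q).comp hdec).map h₄
    obtain ⟨c, hc⟩ := ToPartrec.Code.exists_code (Nat.Partrec'.part_iff₁.2 h₁)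
    refine ⟨c, fun n => (hc (n ::ᵥ .nil)).trans ?_⟩
    change Part.map _ (Part.map _ _) = _
    rw [Part.map_map]
    rfl
  choose code hcode using hcode
  obtain ⟨N, hN⟩ := exists_rtm_machine P code q₀ i j hij
  refine ⟨N, (branchingBisimilar_machine P q₀ x₀ (enc := Encodable.encode) (dec := dec)
    (code := code) ?_ ?_ hcode).trans hN⟩
  · intro b y
    simp [dec]
  · change (Encodable.decode (Nat.div2 0)).getD x₀ = x₀
    rw [Nat.div2_zero, ← hx₀, Encodable.encodek]
    rfl

end CtlProgram

/-! ### Finitely branching computations -/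

namespace ChoiceStep

variable {C K : Type*} (step : C → K → Option C) (ks : List K)

/-- The configuration reached by making the choices in a list. -/
def run (c : C) (p : List K) : Option C := p.foldl (fun o k => o.bind fun d => step d k) (some c)

theorem run_append (c : C) (p : List K) (k : K) :
    run step c (p ++ [k]) = (run step c p).bind fun d => step d k := by
  simp [run]

/-- The successors of a configuration. -/
def succs (c : C) : List C := ks.filterMap (step c)

/-- The configurations reached in `n` steps. -/
def level (c : C) (n : ℕ) : List C :=
  n.rec [c] fun _ l => l.flatMap (succs step ks)

theorem level_zero (c : C) : level step ks c 0 = [c] := rfl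

theorem level_succ (c : C) (n : ℕ) :
    level step ks c (n + 1) = (level step ks c n).flatMap (succs step ks) := rfl

/-- The definition of `level` extends computations at the end; splitting off the first step is what
König's lemma needs. -/
theorem level_succ' (c : C) (n : ℕ) :
    level step ks c (n + 1) = (succs step ks c).flatMap fun d => level step ks d n := by
  induction n with
  | zero => simp [level_succ, level_zero]
  | succ n ih =>
    rw [level_succ, ih, List.flatMap_assoc]
    rfl

theorem level_eq_nil_of_le {c : C} {m n : ℕ} (hmn : m ≤ n) (h : level step ks c m = []) :
    level step ks c n = [] := by
  induction n, hmn using Nat.le_induction with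
  | base => exact h
  | succ n _ ih => rw [level_succ, ih, List.flatMap_nil]

/-- If every successor had an empty level, then, there being finitely many successors, one depth
would be empty for all of them, and the next level of `c` would be empty. -/
theorem exists_succ_of_level_ne_nil {c : C} (h : ∀ n, level step ks c n ≠ []) :
    ∃ d ∈ succs step ks c, ∀ n, level step ks d n ≠ [] := by
  by_contra! hne
  have h₁ : ∀ᶠ n in Filter.atTop, ∀ d ∈ {d | d ∈ succs step ks c}, level step ks d n = [] := by
    rw [Filter.eventually_all_finite (List.finite_toSet _)]
    intro d hd
    obtain ⟨m, hm⟩ := hne d hd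
    exact Filter.eventually_atTop.2 ⟨m, fun n hn => level_eq_nil_of_le step ks hn hm⟩
  obtain ⟨n, hn⟩ := h₁.exists
  refine h (n + 1) ?_
  rw [level_succ', List.flatMap_eq_nil_iff]
  exact hn

/-- König's lemma: if there are computations of each length then there is an infinite one. -/
theorem exists_infinite_of_level_ne_nil {c : C} (h : ∀ n, level step ks c n ≠ []) :
    ∃ f : ℕ → C, f 0 = c ∧ ∀ n, f (n + 1) ∈ succs step ks (f n) := by
  let S := {c : C // ∀ n, level step ks c n ≠ []}
  have hS (s : S) : ∃ t : S, t.1 ∈ succs step ks s.1 := by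
    obtain ⟨d, hd, hd'⟩ := exists_succ_of_level_ne_nil step ks s.2
    exact ⟨⟨d, hd'⟩, hd⟩
  choose g hg using hS
  refine ⟨fun n => (g^[n] ⟨c, h⟩).1, rfl, fun n => ?_⟩
  dsimp only
  rw [Function.iterate_succ_apply']
  exact hg _

theorem exists_run_succs_nil {c : C} {n : ℕ} (h : level step ks c n = []) :
    ∃ p d, run step c p = some d ∧ succs step ks d = [] := by
  suffices H : ∀ p₀ d₀, run step c p₀ = some d₀ → level step ks d₀ n = [] →
      ∃ p d, run step c p = some d ∧ succs step ks d = [] from H [] c rfl h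
  clear h
  induction n with
  | zero =>
    intro _ d₀ _ h
    simp [level_zero] at h
  | succ n ih =>
    intro p₀ d₀ hc h
    cases hs : succs step ks d₀ with
    | nil => exact ⟨p₀, d₀, hc, hs⟩
    | cons d l =>
      have hd : d ∈ succs step ks d₀ := by simp [hs]
      obtain ⟨k, _, hk⟩ := List.mem_filterMap.1 hd
      refine ih (p₀ ++ [k]) d ?_ ?_
      · rw [run_append, hc]
        exact hk
      · rw [level_succ', List.flatMap_eq_nil_iff] at h
        exact h d hd

variable [Primcodable K]

variable {step}

theorem primrec_run [Primcodable C] (hs : Primrec₂ step) : Primrec₂ (run step) := by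
  refine Primrec.list_foldl (h := fun _ (x : Option C × K) => x.1.bind fun d => step d x.2)
    Primrec.snd (Primrec.option_some.comp Primrec.fst) ?_
  refine Primrec.option_bind (Primrec.fst.comp Primrec.snd) ?_
  exact hs.comp Primrec.snd (Primrec.snd.comp (Primrec.snd.comp Primrec.fst))

theorem primrec_level [Primcodable C] (hs : Primrec₂ step) : Primrec₂ (level step ks) := by
  refine Primrec.nat_rec (g := fun _ (x : ℕ × List C) => x.2.flatMap (succs step ks))
    (Primrec.list_cons.comp Primrec.id (Primrec.const [])) ?_
  refine Primrec.list_flatMap (Primrec.snd.comp Primrec.snd) ?_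
  refine Primrec.listFilterMap (Primrec.const ks) ?_
  exact hs.comp (Primrec.snd.comp Primrec.fst) Primrec.snd

/-- The result of the computation described by the guess `e`, if `e` describes a computation that
ends with a result. -/
def guess {R : Type*} (step : C → K → Option C) (result : C → Option R) (c : C) (e : ℕ) :
    Option R :=
  ((Encodable.decode e.unpair.1 : Option (Option (List K))).bind id).bind fun p =>
    (run step c p).bind result

theorem primrec_guess {R : Type*} [Primcodable R] [Primcodable C] (hs : Primrec₂ step)
    {result : C → Option R} (hr : Primrec result) : Primrec₂ (guess step result) := by
  refine Primrec.option_bind (Primrec.option_bind (Primrec.decode.comp (Primrec.fst.comp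
    (Primrec.unpair.comp Primrec.snd))) Primrec.snd) ?_
  refine Primrec.option_bind ((primrec_run hs).comp (Primrec.fst.comp Primrec.fst) Primrec.snd) ?_
  exact hr.comp Primrec.snd

theorem guess_eq_some {R : Type*} {result : C → Option R} {c : C} {e : ℕ} {r : R}
    (h : guess step result c e = some r) : ∃ p d, run step c p = some d ∧ result d = some r := by
  obtain ⟨p, _, h⟩ := Option.bind_eq_some_iff.1 h
  obtain ⟨d, hd, h⟩ := Option.bind_eq_some_iff.1 h
  exact ⟨p, d, hd, h⟩

/-- The counter of guesses only grows, so a guess beyond any bound `e₀` is needed. The second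
component of the pair is padding that supplies it. -/
theorem exists_guess_eq_some {R : Type*} {result : C → Option R} {c d : C} {p : List K} {r : R}
    (hd : run step c p = some d) (hr : result d = some r) (e₀ : ℕ) :
    ∃ e ≥ e₀, guess step result c e = some r := by
  refine ⟨Nat.pair (Encodable.encode (some p)) e₀, Nat.right_le_pair _ _, ?_⟩
  simp only [guess, Nat.unpair_pair, Encodable.encodek]
  simp [hd, hr]

theorem exists_guess_eq_none {R : Type*} (result : C → Option R) (c : C) (e₀ : ℕ) :
    ∃ e ≥ e₀, guess step result c e = none := by
  refine ⟨Nat.pair (Encodable.encode (none : Option (List K))) e₀, Nat.right_le_pair _ _, ?_⟩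
  simp only [guess, Nat.unpair_pair, Encodable.encodek]
  rfl

/-- The result of the guessed computation, if there is one. Otherwise, search the computation
tree: if it is finite, return some result; if it is infinite, diverge. -/
def outcome {R : Type*} (step : C → K → Option C) (ks : List K) (result : C → Option R)
    (x : C × ℕ) : Part R :=
  cond (guess step result x.1 x.2).isSome (Part.ofOption (guess step result x.1 x.2))
    ((Nat.rfind fun n => Part.some (level step ks x.1 n).isEmpty).bind fun _ =>
      Nat.rfindOpt (guess step result x.1))

theorem partrec_outcome {R : Type*} [Primcodable R] [Primcodable C] (hs : Primrec₂ step)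
    {result : C → Option R} (hr : Primrec result) : Partrec (outcome step ks result) := by
  have hg := primrec_guess hs hr
  have hempty : Primrec fun l : List C => l.isEmpty :=
    (Primrec.list_casesOn Primrec.id (Primrec.const true) (Primrec.const false).to₂).of_eq
      fun l => by cases l <;> rfl
  refine Partrec.cond (Primrec.option_isSome.comp hg).to_comp hg.to_comp.ofOption ?_
  refine Partrec.bind (Partrec.rfind ?_) ?_
  · exact (hempty.comp ((primrec_level ks hs).comp (Primrec.fst.comp Primrec.fst)
      Primrec.snd)).to_comp.partrec
  · refine Partrec.comp (f := fun x : C => Nat.rfindOpt (guess step result x)) ?_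
      (Computable.fst.comp Computable.fst)
    exact Partrec.rfindOpt hg.to_comp

variable {ks}

theorem outcome_spec {R : Type*} {result : C → Option R} {c : C} {e : ℕ} {r : R}
    (h : r ∈ outcome step ks result (c, e)) :
    ∃ p d, run step c p = some d ∧ result d = some r := by
  rw [outcome] at h
  cases hg : guess step result c e with
  | some r' =>
    simp only [hg, Option.isSome_some, cond_true, Part.coe_some, Part.mem_some_iff] at h
    subst h
    exact guess_eq_some hg
  | none =>
    simp only [hg, Option.isSome_none, cond_false, Part.mem_bind_iff] at h
    obtain ⟨_, _, h⟩ := h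
    obtain ⟨n, hn⟩ := Nat.rfindOpt_spec h
    exact guess_eq_some hn

theorem mem_outcome {R : Type*} {result : C → Option R} {c : C} {e : ℕ} {r : R}
    (h : guess step result c e = some r) : r ∈ outcome step ks result (c, e) := by
  simp [outcome, h]

/-- A finite tree has a dead end, which has a result by `hres`, and some guess codes the path to it;
so both searches stop. -/
theorem outcome_dom_of_level {R : Type*} {result : C → Option R} {c : C} (e : ℕ) {n : ℕ}
    (hres : ∀ d, succs step ks d = [] → (result d).isSome) (h : level step ks c n = []) :
    (outcome step ks result (c, e)).Dom := by
  cases hg : guess step result c e with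
  | some r' => exact Part.dom_iff_mem.2 ⟨_, mem_outcome hg⟩
  | none =>
    simp only [outcome, hg, Option.isSome_none, cond_false]
    have h₁ : (Nat.rfind fun n => Part.some (level step ks c n).isEmpty).Dom :=
      Nat.rfind_dom.2 ⟨n, by simp [h], fun _ => trivial⟩
    refine ⟨h₁, Nat.rfindOpt_dom.2 ?_⟩
    obtain ⟨p, d, hd, hs⟩ := exists_run_succs_nil step ks h
    obtain ⟨r, hr⟩ := Option.isSome_iff_exists.1 (hres d hs)
    obtain ⟨e, _, he⟩ := exists_guess_eq_some hd hr 0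
    exact ⟨e, r, he⟩

theorem not_outcome_dom {R : Type*} {result : C → Option R} {c : C} {e : ℕ}
    (hg : guess step result c e = none) (h : ∀ n, level step ks c n ≠ []) :
    ¬ (outcome step ks result (c, e)).Dom := by
  simp only [outcome, hg, Option.isSome_none, cond_false]
  rintro ⟨h₁, _⟩
  obtain ⟨n, hn, _⟩ := Nat.rfind_dom.1 h₁
  refine h n ?_
  simpa using hn

end ChoiceStep

/-- A primitive recursive encoding of a finite type. -/
@[reducible]
noncomputable def Primcodable.ofFinite (α : Type*) [Finite α] : Primcodable α :=
  Primcodable.ofEquiv (Fin (Nat.card α)) (Finite.equivFin α)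

/-! ### Simulation of persistent Turing machines -/

instance : Finite HeadMove :=
  Finite.of_injective (β := Fin 3) (fun m => match m with | .left => 0 | .stay => 1 | .right => 2)
    (by intro a b h; cases a <;> cases b <;> simp_all)

namespace PTM

variable {D : Type u}

/-- A tape, given by an initial segment and the head position. -/
abbrev ListTape (D : Type u) : Type u := List (Option D) × ℕ

namespace ListTape

/-- The tape that is represented by a list. -/
def toHalfTape (t : ListTape D) : HalfTape D := ⟨fun n => t.1.getD n none, t.2⟩

/-- The symbol under the head. -/
def read (t : ListTape D) : Option D := t.1.getD t.2 none

/-- Write a symbol in the cell under the head. -/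
def write (t : ListTape D) (b : Option D) : ListTape D :=
  ((List.range (t.1.length + t.2 + 1)).map fun n => if n = t.2 then b else t.1.getD n none, t.2)

/-- Move the head to the right and then to the left. -/
def shift (t : ListTape D) (r l : ℕ) : ListTape D := (t.1, t.2 + r - l)

/-- The content of the tape. -/
def content (t : ListTape D) : List D :=
  t.1.foldr (fun x w => x.elim [] fun d => d :: w) []

theorem toHalfTape_write (t : ListTape D) (b : Option D) :
    (t.write b).toHalfTape = t.toHalfTape.write b := by
  obtain ⟨l, h⟩ := t
  simp only [write, toHalfTape, HalfTape.write, HalfTape.mk.injEq, and_true]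
  funext n
  by_cases hn : n < l.length + h + 1
  · by_cases hnh : n = h
    · subst hnh
      simp [List.getD_eq_getElem?_getD, hn]
    · simp [List.getD_eq_getElem?_getD, hn, hnh]
  · have hnh : n ≠ h := by omega
    have hl : l.length ≤ n := by omega
    simp [List.getD_eq_getElem?_getD, hn, hnh, hl]

theorem toHalfTape_write_read (t : ListTape D) : t.toHalfTape.write t.read = t.toHalfTape := by
  simp [HalfTape.write, toHalfTape, read]

theorem contains_content (t : ListTape D) : t.toHalfTape.Contains t.content := by
  obtain ⟨l, h⟩ := t
  change ∀ n ≤ (content (l, h)).length, l.getD n none = (content (l, h))[n]?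
  induction l with
  | nil => simp [content]
  | cons x l ih =>
    cases x with
    | none => simp [content]
    | some d =>
      intro n hn
      change n ≤ (d :: content (l, h)).length at hn
      change (some d :: l).getD n none = (d :: content (l, h))[n]?
      cases n with
      | zero => rfl
      | succ n => simpa using ih n (by simpa using hn)

end ListTape

theorem HalfTape.Contains.length_le {t : HalfTape D} {w w' : List D} (h : t.Contains w)
    (h' : t.Contains w') : w'.length ≤ w.length := by
  by_contra! hlt
  have h₁ := h w.length le_rfl
  have h₂ := h' w.length hlt.le
  rw [h₁, List.getElem?_eq_none le_rfl, List.getElem?_eq_getElem hlt] at h₂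
  cases h₂

theorem HalfTape.Contains.unique {t : HalfTape D} {w w' : List D} (h : t.Contains w)
    (h' : t.Contains w') : w = w' := by
  have hl : w.length = w'.length := le_antisymm (h'.length_le h) (h.length_le h')
  refine List.ext_getElem? fun n => ?_
  rcases le_or_gt n w.length with hn | hn
  · rw [← h n hn, h' n (hl ▸ hn)]
  · rw [List.getElem?_eq_none hn.le, List.getElem?_eq_none (hl ▸ hn.le)]

variable (M : PTM.{u, v} D)

/-- What a persistent Turing machine may choose in one step: the next state, the symbols to be
written and the head moves. -/
structure Choice where
  state : M.State
  work : Option D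
  output : Option (Option D)
  moveInput : HeadMove
  moveWork : HeadMove
  moveOutput : HeadMove

instance [Finite D] : Finite M.Choice :=
  have := M.finite_state
  Finite.of_injective
    (fun k => (k.state, k.work, k.output, k.moveInput, k.moveWork, k.moveOutput))
    (by rintro ⟨⟩ ⟨⟩ h; simpa using h)

/-- Configurations in which the tapes are given by lists: state, input, work and output tape. -/
abbrev ListConfig : Type max u v := M.State × ListTape D × ListTape D × ListTape D

variable {M}

/-- The configuration that is represented by lists. -/
def ListConfig.toConfig (c : M.ListConfig) : M.Config :=
  ⟨c.1, c.2.1.toHalfTape, c.2.2.1.toHalfTape, c.2.2.2.toHalfTape⟩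

/-- The choice is allowed in the given state and for the given symbols. -/
def Choice.Enabled (q : M.State) (a b : Option D) (k : M.Choice) : Prop :=
  M.trans q a b k.state k.work k.output k.moveInput k.moveWork k.moveOutput

/-- The number of cells that the head moves to the right. -/
def _root_.HeadMove.right' : HeadMove → ℕ
  | .right => 1
  | _ => 0

/-- The number of cells that the head moves to the left. -/
def _root_.HeadMove.left' : HeadMove → ℕ
  | .left => 1
  | _ => 0

theorem ListTape.toHalfTape_shift (t : ListTape D) (m : HeadMove) :
    (t.shift m.right' m.left').toHalfTape = t.toHalfTape.move m := by
  cases m <;> rfl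

/-- The next configuration determined by a choice. -/
def nextConfig (c : M.ListConfig) (k : M.Choice) : M.ListConfig :=
  (k.state, c.2.1.shift k.moveInput.right' k.moveInput.left',
    (c.2.2.1.write k.work).shift k.moveWork.right' k.moveWork.left',
    (c.2.2.2.write (k.output.getD c.2.2.2.read)).shift k.moveOutput.right' k.moveOutput.left')

open scoped Classical in
/-- The step determined by a choice, if the choice is allowed. -/
noncomputable def listStep (c : M.ListConfig) (k : M.Choice) : Option M.ListConfig :=
  bif decide (Choice.Enabled c.1 c.2.1.read c.2.2.1.read k) then some (nextConfig c k) else none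

theorem listStep_eq_some_iff (c d : M.ListConfig) (k : M.Choice) :
    listStep c k = some d ↔
      Choice.Enabled c.1 c.2.1.read c.2.2.1.read k ∧ nextConfig c k = d := by
  by_cases h : Choice.Enabled c.1 c.2.1.read c.2.2.1.read k <;> simp [listStep, h]

theorem step_iff_exists_listStep (c : M.ListConfig) (c' : M.Config) :
    M.Step c.toConfig c' ↔ ∃ k d, listStep c k = some d ∧ c' = d.toConfig := by
  classical
  -- Leaving the output cell alone is the same as writing back the symbol that it holds.
  have hout (x : Option (Option D)) (t : ListTape D) : (t.write (x.getD t.read)).toHalfTape =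
      (match x with
        | none => t.toHalfTape
        | some y => t.toHalfTape.write y) := by
    cases x with
    | none => rw [Option.getD_none, ListTape.toHalfTape_write, ListTape.toHalfTape_write_read]
    | some y => rw [Option.getD_some, ListTape.toHalfTape_write]
  constructor
  · rintro ⟨b, x, mi, mw, mo, h, hi, hw, ho⟩
    refine ⟨⟨c'.state, b, x, mi, mw, mo⟩, _, (listStep_eq_some_iff _ _ _).2 ⟨h, rfl⟩, ?_⟩
    obtain ⟨q', i', w', o'⟩ := c'
    simp only [ListConfig.toConfig] at hi hw ho
    simp only [ListConfig.toConfig, nextConfig, ListTape.toHalfTape_shift, ListTape.toHalfTape_write _ b,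
      hout, hi, hw, ho]
  · rintro ⟨k, d, hd, rfl⟩
    obtain ⟨h, rfl⟩ := (listStep_eq_some_iff _ _ _).1 hd
    refine ⟨k.work, k.output, k.moveInput, k.moveWork, k.moveOutput, h, ?_, ?_, ?_⟩
    · exact ListTape.toHalfTape_shift _ _
    · exact (ListTape.toHalfTape_shift _ _).trans (by rw [ListTape.toHalfTape_write]; rfl)
    · exact (ListTape.toHalfTape_shift _ _).trans (by rw [hout]; rfl)

open ChoiceStep

theorem reflTransGen_step_iff (c : M.ListConfig) (c' : M.Config) :
    ReflTransGen M.Step c.toConfig c' ↔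
      ∃ p d, run listStep c p = some d ∧ c' = d.toConfig := by
  constructor
  · intro h
    induction h with
    | refl => exact ⟨[], c, rfl, rfl⟩
    | tail _ h ih =>
      obtain ⟨p, d, hd, rfl⟩ := ih
      obtain ⟨k, d', hd', rfl⟩ := (step_iff_exists_listStep _ _).1 h
      exact ⟨p ++ [k], d', by rw [run_append, hd]; exact hd', rfl⟩
  · rintro ⟨p, d, hd, rfl⟩
    induction p using List.reverseRecOn generalizing d with
    | nil =>
      cases hd
      exact ReflTransGen.refl
    | append_singleton p k ih =>
      rw [run_append] at hd
      obtain ⟨d', hd', hk⟩ := Option.bind_eq_some_iff.1 hd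
      exact (ih d' hd').tail ((step_iff_exists_listStep _ _).2 ⟨k, d, hk, rfl⟩)

open scoped Classical in
/-- The contents of the work and the output tape, if the configuration is halted. -/
noncomputable def listResult (c : M.ListConfig) : Option (List D × List D) :=
  bif decide (∀ k, ¬ Choice.Enabled c.1 c.2.1.read c.2.2.1.read k) then
    some (c.2.2.1.content, c.2.2.2.content)
  else none

theorem halted_iff (c : M.ListConfig) :
    M.Halted c.toConfig ↔ ∀ k, ¬ Choice.Enabled c.1 c.2.1.read c.2.2.1.read k := by
  constructor
  · intro h k hk
    exact h _ ((step_iff_exists_listStep c _).2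
      ⟨k, _, (listStep_eq_some_iff _ _ _).2 ⟨hk, rfl⟩, rfl⟩)
  · intro h c' hc'
    obtain ⟨k, d, hd, -⟩ := (step_iff_exists_listStep c _).1 hc'
    exact h k ((listStep_eq_some_iff _ _ _).1 hd).1

theorem listResult_eq_some_iff (c : M.ListConfig) (r : List D × List D) :
    listResult c = some r ↔ M.Halted c.toConfig ∧ c.toConfig.work.Contains r.1 ∧
      c.toConfig.output.Contains r.2 := by
  classical
  rw [halted_iff, listResult]
  by_cases h : ∀ k, ¬ Choice.Enabled c.1 c.2.1.read c.2.2.1.read k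
  · rw [decide_eq_true h, cond_true, Option.some.injEq]
    constructor
    · rintro rfl
      exact ⟨h, ListTape.contains_content _, ListTape.contains_content _⟩
    · rintro ⟨_, h₁, h₂⟩
      exact Prod.ext ((ListTape.contains_content c.2.2.1).unique h₁)
        ((ListTape.contains_content c.2.2.2).unique h₂)
  · simp [h]

/-- The configuration in which a macrostep starts. -/
def listStart (M : PTM.{u, v} D) (w wi : List D) : M.ListConfig :=
  (M.start, (wi.map some, 0), (w.map some, 0), ([], 0))

theorem toConfig_listStart (w wi : List D) :
    (listStart M w wi).toConfig = M.startConfig w wi := by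
  have h (w : List D) : ListTape.toHalfTape (w.map some, 0) = HalfTape.ofWord w := by
    simp only [ListTape.toHalfTape, HalfTape.ofWord, HalfTape.mk.injEq, and_true]
    funext n
    rw [List.getD_eq_getElem?_getD, List.getElem?_map]
    cases w[n]? <;> rfl
  rw [ListConfig.toConfig, startConfig, ← h w, ← h wi, ← h []]
  rfl

/-! ### Primitive recursiveness of the tape operations. -/

section Primrec

variable [Primcodable D]

theorem primrec_read : Primrec (ListTape.read : ListTape D → Option D) :=
  (Primrec.list_getD none).comp Primrec.fst Primrec.snd

theorem primrec_write : Primrec₂ (ListTape.write : ListTape D → Option D → ListTape D) := by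
  refine Primrec.pair (Primrec.list_map (Primrec.list_range.comp (Primrec.succ.comp
    (Primrec.nat_add.comp (Primrec.list_length.comp (Primrec.fst.comp Primrec.fst))
      (Primrec.snd.comp Primrec.fst)))) ?_) (Primrec.snd.comp Primrec.fst)
  refine Primrec.ite ?_ (Primrec.snd.comp Primrec.fst) ?_
  · exact Primrec.eq.comp Primrec.snd (Primrec.snd.comp (Primrec.fst.comp Primrec.fst))
  · exact (Primrec.list_getD none).comp (Primrec.fst.comp (Primrec.fst.comp Primrec.fst))
      Primrec.snd

theorem primrec_shift {α : Type*} [Primcodable α] {t : α → ListTape D} {r l : α → ℕ}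
    (ht : Primrec t) (hr : Primrec r) (hl : Primrec l) : Primrec fun x => (t x).shift (r x) (l x) :=
  Primrec.pair (Primrec.fst.comp ht)
    (Primrec.nat_sub.comp (Primrec.nat_add.comp (Primrec.snd.comp ht) hr) hl)

theorem primrec_content : Primrec (ListTape.content : ListTape D → List D) := by
  refine Primrec.list_foldr (h := fun _ (x : Option D × List D) => x.1.elim [] fun d => d :: x.2)
    Primrec.fst (Primrec.const []) ?_
  have h : Primrec fun x : ListTape D × Option D × List D =>
      (Option.casesOn x.2.1 [] fun d => d :: x.2.2 : List D) := by
    refine Primrec.option_casesOn (Primrec.fst.comp Primrec.snd) (Primrec.const []) ?_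
    exact Primrec.list_cons.comp Primrec.snd (Primrec.snd.comp (Primrec.snd.comp Primrec.fst))
  exact h.of_eq fun x => by rcases x with ⟨_, _ | _, _⟩ <;> rfl

end Primrec

/-! ### Macrosteps as a partial recursive function of work tape, input and guess. -/

section Computable

variable [Finite D]

/-- A list of all choices. -/
noncomputable def choices (M : PTM.{u, v} D) : List M.Choice :=
  (Finite.exists_univ_list M.Choice).choose

theorem mem_choices (k : M.Choice) : k ∈ M.choices :=
  (Finite.exists_univ_list M.Choice).choose_spec.2 k

theorem step_iff_exists_mem_succs (c : M.ListConfig) (c' : M.Config) :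
    M.Step c.toConfig c' ↔ ∃ d ∈ succs listStep M.choices c, c' = d.toConfig := by
  rw [step_iff_exists_listStep]
  constructor
  · rintro ⟨k, d, hd, rfl⟩
    exact ⟨d, List.mem_filterMap.2 ⟨k, mem_choices k, hd⟩, rfl⟩
  · rintro ⟨d, hd, rfl⟩
    obtain ⟨k, _, hk⟩ := List.mem_filterMap.1 hd
    exact ⟨k, d, hk, rfl⟩

theorem isSome_listResult {c : M.ListConfig} (h : succs listStep M.choices c = []) :
    (listResult c).isSome := by
  have h₁ : M.Halted c.toConfig := fun c' hc' => by
    obtain ⟨d, hd, _⟩ := (step_iff_exists_mem_succs c c').1 hc'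
    simp [h] at hd
  rw [halted_iff] at h₁
  simp [listResult, h₁]

theorem level_ne_nil_of_infinite {c₀ : M.ListConfig} {c : ℕ → M.Config} (h0 : c 0 = c₀.toConfig)
    (hs : ∀ n, M.Step (c n) (c (n + 1))) (n : ℕ) : level listStep M.choices c₀ n ≠ [] := by
  suffices ∃ d ∈ level listStep M.choices c₀ n, c n = d.toConfig by
    obtain ⟨d, hd, _⟩ := this
    exact List.ne_nil_of_mem hd
  induction n with
  | zero => exact ⟨c₀, List.mem_singleton_self _, h0⟩
  | succ n ih =>
    obtain ⟨d, hd, hcd⟩ := ih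
    have h := hs n
    rw [hcd, step_iff_exists_mem_succs] at h
    obtain ⟨d', hd', h'⟩ := h
    exact ⟨d', List.mem_flatMap.2 ⟨d, hd, hd'⟩, h'⟩

noncomputable instance : Primcodable M.Choice := Primcodable.ofFinite _

/-- The computation of a macrostep, given the work tape, the input and a guess: the result consists
of the contents of the work and the output tape. -/
noncomputable def simulate (M : PTM.{u, v} D) (x : List D × List D × ℕ) : Part (List D × List D) :=
  outcome listStep M.choices listResult (listStart M x.1 x.2.1, x.2.2)

theorem macrostep_of_mem_simulate {w wi : List D} {e : ℕ} {r : List D × List D}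
    (h : r ∈ M.simulate (w, wi, e)) : M.Macrostep (.word w) wi (.word r.2) (.word r.1) := by
  obtain ⟨p, d, hd, hr⟩ := outcome_spec h
  obtain ⟨hh, hw, ho⟩ := (listResult_eq_some_iff d r).1 hr
  refine .halt w wi r.2 r.1 d.toConfig ?_ hh hw ho
  rw [← toConfig_listStart]
  exact (reflTransGen_step_iff _ _).2 ⟨p, d, hd, rfl⟩

/-- If the simulation diverges then no level of the computation tree is empty, and König's lemma
gives an infinite computation. -/
theorem macrostep_of_not_simulate_dom {w wi : List D} {e : ℕ} (h : ¬ (M.simulate (w, wi, e)).Dom) :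
    M.Macrostep (.word w) wi .mu .infinity := by
  have h₁ (n : ℕ) : level listStep M.choices (listStart M w wi) n ≠ [] := fun hn =>
    h (outcome_dom_of_level e (fun _ hd => isSome_listResult hd) hn)
  obtain ⟨f, hf₀, hf⟩ := exists_infinite_of_level_ne_nil _ _ h₁
  refine .diverge w wi (fun n => (f n).toConfig) ?_ fun n => ?_
  · rw [hf₀, toConfig_listStart]
  · exact (step_iff_exists_mem_succs _ _).2 ⟨_, hf n, rfl⟩

/-- A halting computation is selected by its code, a diverging one by a guess that codes nothing.
The freedom in `e₀` allows for a counter that has already advanced. -/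
theorem exists_simulate_of_macrostep {w wi : List D} {wo : Output D} {t : MacroState D}
    (h : M.Macrostep (.word w) wi wo t) (e₀ : ℕ) : ∃ e ≥ e₀,
      (∃ r ∈ M.simulate (w, wi, e), wo = .word r.2 ∧ t = .word r.1) ∨
      (¬ (M.simulate (w, wi, e)).Dom ∧ wo = .mu ∧ t = .infinity) := by
  cases h with
  | halt _ _ wo w' c hc hh hw ho =>
    rw [← toConfig_listStart] at hc
    obtain ⟨p, d, hd, rfl⟩ := (reflTransGen_step_iff _ _).1 hc
    have hr : listResult d = some (w', wo) := (listResult_eq_some_iff d _).2 ⟨hh, hw, ho⟩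
    obtain ⟨e, he, hg⟩ := exists_guess_eq_some hd hr e₀
    exact ⟨e, he, Or.inl ⟨_, mem_outcome hg, rfl, rfl⟩⟩
  | diverge _ _ c h0 hs =>
    rw [← toConfig_listStart] at h0
    obtain ⟨e, he, hg⟩ := exists_guess_eq_none (step := listStep) listResult (listStart M w wi) e₀
    exact ⟨e, he, Or.inr ⟨not_outcome_dom hg (level_ne_nil_of_infinite h0 hs), rfl, rfl⟩⟩

variable [Primcodable D] [Primcodable M.State]

/-- The transition relation is an arbitrary predicate, but it depends only on finite data, and every
function on a finite type is primitive recursive. -/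
theorem primrec_listStep : Primrec₂ (listStep : M.ListConfig → M.Choice → Option M.ListConfig) := by
  classical
  have := M.finite_state
  have hk : Primrec fun x : M.ListConfig × M.Choice => x.2 := Primrec.snd
  have hi : Primrec fun x : M.ListConfig × M.Choice => x.1.2.1 :=
    Primrec.fst.comp (Primrec.snd.comp Primrec.fst)
  have hw : Primrec fun x : M.ListConfig × M.Choice => x.1.2.2.1 :=
    Primrec.fst.comp (Primrec.snd.comp (Primrec.snd.comp Primrec.fst))
  have ho : Primrec fun x : M.ListConfig × M.Choice => x.1.2.2.2 :=
    Primrec.snd.comp (Primrec.snd.comp (Primrec.snd.comp Primrec.fst))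
  refine Primrec.cond ?_ (Primrec.option_some.comp ?_) (Primrec.const none)
  · exact (Primrec.dom_finite fun x : M.State × Option D × Option D × M.Choice =>
      decide (Choice.Enabled x.1 x.2.1 x.2.2.1 x.2.2.2)).comp
      ((Primrec.fst.comp Primrec.fst).pair
        ((primrec_read.comp hi).pair ((primrec_read.comp hw).pair hk)))
  · refine ((Primrec.dom_finite Choice.state).comp hk).pair (Primrec.pair ?_ (Primrec.pair ?_ ?_))
    · exact primrec_shift hi ((Primrec.dom_finite fun k => k.moveInput.right').comp hk)
        ((Primrec.dom_finite fun k => k.moveInput.left').comp hk)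
    · exact primrec_shift (primrec_write.comp hw ((Primrec.dom_finite Choice.work).comp hk))
        ((Primrec.dom_finite fun k => k.moveWork.right').comp hk)
        ((Primrec.dom_finite fun k => k.moveWork.left').comp hk)
    · exact primrec_shift (primrec_write.comp ho
        (Primrec.option_getD.comp ((Primrec.dom_finite Choice.output).comp hk)
          (primrec_read.comp ho)))
        ((Primrec.dom_finite fun k => k.moveOutput.right').comp hk)
        ((Primrec.dom_finite fun k => k.moveOutput.left').comp hk)

theorem primrec_listResult :
    Primrec (listResult : M.ListConfig → Option (List D × List D)) := by
  classical
  have := M.finite_state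
  have hi : Primrec fun x : M.ListConfig => x.2.1 := Primrec.fst.comp Primrec.snd
  have hw : Primrec fun x : M.ListConfig => x.2.2.1 :=
    Primrec.fst.comp (Primrec.snd.comp Primrec.snd)
  have ho : Primrec fun x : M.ListConfig => x.2.2.2 :=
    Primrec.snd.comp (Primrec.snd.comp Primrec.snd)
  refine Primrec.cond ?_ (Primrec.option_some.comp
    ((primrec_content.comp hw).pair (primrec_content.comp ho))) (Primrec.const none)
  exact (Primrec.dom_finite fun x : M.State × Option D × Option D =>
      decide (∀ k, ¬ Choice.Enabled x.1 x.2.1 x.2.2 k)).comp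
    (Primrec.fst.pair ((primrec_read.comp hi).pair (primrec_read.comp hw)))

theorem partrec_simulate : Partrec M.simulate := by
  have hmap : Primrec fun w : List D => ((w.map some, 0) : ListTape D) :=
    (Primrec.list_map Primrec.id (Primrec.option_some.comp Primrec.snd).to₂).pair
      (Primrec.const 0)
  refine (partrec_outcome M.choices primrec_listStep primrec_listResult).comp (Primrec.to_comp ?_)
  refine Primrec.pair (Primrec.pair (Primrec.const M.start) ?_) (Primrec.snd.comp Primrec.snd)
  exact (hmap.comp (Primrec.fst.comp Primrec.snd)).pair
    ((hmap.comp Primrec.fst).pair (Primrec.const _))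

end Computable

end PTM

namespace PTM

variable {D : Type u}

/-! ### The control program of a persistent Turing machine -/

/-- The control states. In `next` and `recv` the machine is in input mode; `simulate` computes a
macrostep; `out c` compares the next output symbol with `c` (`none` stands for `#`), and `pop`
removes it. -/
inductive Ctl (D : Type u) : Type u where
  | next : Ctl D
  | recv : D → Ctl D
  | simulate : Ctl D
  | out : Option D → Ctl D
  | pop : Ctl D

/-- The control states of the input mode. -/
def Ctl.IsInput : Ctl D → Prop
  | .next => True
  | .recv _ => True
  | _ => False

instance [Finite D] : Finite (Ctl D) :=
  Finite.of_injective (β := Option D ⊕ Option D ⊕ Bool)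
    (fun q => match q with
      | .next => .inl none
      | .recv d => .inl (some d)
      | .out c => .inr (.inl c)
      | .simulate => .inr (.inr false)
      | .pop => .inr (.inr true))
    (by intro a b h; cases a <;> cases b <;> simp_all)

/-- The actions that are offered in a control state. -/
inductive Offer : Ctl D → Bool → Option (PortAction D) → Ctl D → Prop where
  | recv (q b d) (hq : q.IsInput) : Offer q b (some (.recv (.data d))) (.recv d)
  | hash (q b) (hq : q.IsInput) : Offer q b (some (.recv .hash)) .simulate
  | next (q b) (hq : q.IsInput) : Offer q b none .next
  | simulate (b c) : Offer .simulate b none (.out c)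
  | pop (b c) : Offer .pop b none (.out c)
  | retry (c c') : Offer (.out c) false none (.out c')
  | send (d) : Offer (.out (some d)) true (some (.send (.data d))) .pop
  | finish : Offer (.out none) true (some (.send .hash)) .next

variable [Finite D]

open scoped Classical in
/-- The control program that corresponds to the encoding of a persistent Turing machine. In input
mode the data are the work tape, the input received so far, and a guess; in output mode they are
the work tape, the remaining output, and a number without meaning. -/
noncomputable def ctlProgram (M : PTM.{u, v} D) :
    CtlProgram (PortAction D) (Ctl D) (List D × List D × ℕ) where
  run q x :=
    match q with
    | .next => Part.some ((x.1, x.2.1, x.2.2 + 1), true)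
    | .recv d => Part.some ((x.1, x.2.1 ++ [d], x.2.2), true)
    | .simulate => (M.simulate x).map fun r => ((r.1, r.2, 0), true)
    | .out c => Part.some (x, decide (x.2.1.head? = c))
    | .pop => Part.some ((x.1, x.2.1.tail, x.2.2), true)
  offer := Offer

theorem partrec_ctlProgram [Primcodable D] (M : PTM.{u, v} D) (q : Ctl D) :
    Partrec (M.ctlProgram.run q) := by
  classical
  have := M.finite_state
  let _ : Primcodable M.State := Primcodable.ofFinite _
  have h₁ : Primrec fun x : List D × List D × ℕ => x.1 := Primrec.fst
  have h₂ : Primrec fun x : List D × List D × ℕ => x.2.1 := Primrec.fst.comp Primrec.snd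
  have h₃ : Primrec fun x : List D × List D × ℕ => x.2.2 := Primrec.snd.comp Primrec.snd
  cases q with
  | next =>
    exact ((h₁.pair (h₂.pair (Primrec.succ.comp h₃))).pair (Primrec.const true)).to_comp.partrec
  | recv d =>
    exact ((h₁.pair ((Primrec.list_concat.comp h₂ (Primrec.const d)).pair h₃)).pair
      (Primrec.const true)).to_comp.partrec
  | simulate =>
    refine partrec_simulate.map (Primrec.to_comp ?_)
    exact ((Primrec.fst.comp Primrec.snd).pair ((Primrec.snd.comp Primrec.snd).pair
      (Primrec.const 0))).pair (Primrec.const true)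
  | out c =>
    refine (Primrec.id.pair ?_).to_comp.partrec
    exact (Primrec.eq.comp (Primrec.list_head?.comp h₂) (Primrec.const c)).decide
  | pop =>
    exact ((h₁.pair ((Primrec.list_tail.comp h₂).pair h₃)).pair
      (Primrec.const true)).to_comp.partrec

variable (M : PTM.{u, v} D)

/-- The transition system of the control program. -/
noncomputable abbrev ctlLTS : LTS (PortAction D) := M.ctlProgram.toLTS .next ([], [], 0)

/-- The relation between the encoding of a persistent Turing machine and its control program. -/
inductive CtlRel : ITS.EncState M.toITS.State D → Ctl D × List D × List D × ℕ → Prop where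
  -- A program state carries the data `x` before its computation; the encoded state is read off the
  -- result `y`. An undefined computation thus stands for divergence.
  | inp (s : M.toITS.State) (q x y b) (hq : q.IsInput) (hy : (y, b) ∈ M.ctlProgram.run q x)
      (hs : s.1 = .word y.1) : CtlRel (.inp s y.2.1) (q, x)
  | out (s : M.toITS.State) (q x y b) (hq : ¬ q.IsInput) (hy : (y, b) ∈ M.ctlProgram.run q x)
      (hs : s.1 = .word y.1) : CtlRel (.out s (.word y.2.1)) (q, x)
  | div (s : M.toITS.State) (q x) (hq : ¬ (M.ctlProgram.run q x).Dom) (hs : s.1 = .infinity) :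
      CtlRel (.out s .mu) (q, x)

variable {M}

theorem CtlRel.next {s : M.toITS.State} {w : List D} (hs : s.1 = .word w) (wi : List D) (e : ℕ) :
    M.CtlRel (.inp s wi) (.next, w, wi, e) :=
  .inp s .next (w, wi, e) (w, wi, e + 1) true trivial (Part.mem_some _) hs

theorem CtlRel.recv {s : M.toITS.State} {w : List D} (hs : s.1 = .word w) (wi : List D) (d : D)
    (e : ℕ) : M.CtlRel (.inp s (wi ++ [d])) (.recv d, w, wi, e) :=
  .inp s (.recv d) (w, wi, e) (w, wi ++ [d], e) true trivial (Part.mem_some _) hs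

theorem CtlRel.out' {s : M.toITS.State} {w : List D} (hs : s.1 = .word w) (wo : List D) (e : ℕ)
    (c : Option D) : M.CtlRel (.out s (.word wo)) (.out c, w, wo, e) :=
  .out s (.out c) (w, wo, e) (w, wo, e) _ id (Part.mem_some _) hs

theorem CtlRel.pop {s : M.toITS.State} {w : List D} (hs : s.1 = .word w) (d : D) (wo : List D)
    (e : ℕ) : M.CtlRel (.out s (.word wo)) (.pop, w, d :: wo, e) :=
  .out s .pop (w, d :: wo, e) (w, wo, e) true id (Part.mem_some _) hs

/-- In input mode each larger guess can be reached. -/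
theorem exists_taus_guess {q : Ctl D} {x y : List D × List D × ℕ} {b : Bool} (hq : q.IsInput)
    (hy : (y, b) ∈ M.ctlProgram.run q x) {e : ℕ} (he : y.2.2 ≤ e) :
    ∃ q' x' b', q'.IsInput ∧ ((y.1, y.2.1, e), b') ∈ M.ctlProgram.run q' x' ∧
      M.ctlLTS.taus (q, x) (q', x') := by
  induction e, he using Nat.le_induction with
  | base => exact ⟨q, x, b, hq, hy, ReflTransGen.refl⟩
  | succ e _ ih =>
    obtain ⟨q', x', b', hq', hy', ht⟩ := ih
    exact ⟨.next, (y.1, y.2.1, e), true, trivial, Part.mem_some _,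
      ht.tail ⟨b', hy', .next q' b' hq'⟩⟩

/-- In output mode each symbol can be tried as the next output symbol. -/
theorem taus_out {q : Ctl D} {x y : List D × List D × ℕ} {b : Bool} (hq : ¬ q.IsInput)
    (hy : (y, b) ∈ M.ctlProgram.run q x) {c : Option D} (hc : y.2.1.head? = c) :
    M.ctlLTS.taus (q, x) (.out c, y) := by
  cases q with
  | next => exact absurd trivial hq
  | recv d => exact absurd trivial hq
  | simulate => exact ReflTransGen.single ⟨b, hy, .simulate b c⟩
  | pop => exact ReflTransGen.single ⟨b, hy, .pop b c⟩
  | out c' =>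
    have hy' := hy
    obtain ⟨h₁, h₂⟩ := Prod.ext_iff.1 (Part.mem_some_iff.1 hy)
    dsimp only at h₁ h₂
    subst h₁ h₂
    by_cases h : y.2.1.head? = c'
    · have hcc : c' = c := h.symm.trans hc
      rw [hcc]
      exact ReflTransGen.refl
    · refine ReflTransGen.single ⟨false, ?_, .retry c' c⟩
      simp only [h, decide_false] at hy'
      exact hy'

theorem head?_eq_of_mem_run_out {c : Option D} {x y : List D × List D × ℕ}
    (h : (y, true) ∈ M.ctlProgram.run (.out c) x) : y = x ∧ x.2.1.head? = c := by
  classical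
  have h₁ := Part.mem_some_iff.1 h
  simpa [Prod.ext_iff] using h₁

/-- Increasing the guess and trying an output symbol do not change the encoded state, so these steps
are inert. The commitment is made by `i?#`, whose guess determines the outcome. -/
theorem isBranchingBisimulation_ctlRel :
    LTS.IsBranchingBisimulation M.toLTS M.ctlLTS M.CtlRel where
  step_left := by
    rintro s₁ s₂ h a t₁ ht
    cases h with
    | inp s q x y b hq hy hs =>
      cases ht with
      | recv _ _ d =>
        exact ⟨(q, x), (.recv d, y), ReflTransGen.refl, Or.inl ⟨b, hy, .recv q b d hq⟩,
          .inp s q x y b hq hy hs, CtlRel.recv hs _ _ _⟩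
      | macrostep _ _ wo t htr =>
        change M.Macrostep s.1 y.2.1 wo t.1 at htr
        rw [hs] at htr
        -- The guess is taken no smaller than the current one, so that it can be reached by counting
        -- up.
        obtain ⟨e, he, hres⟩ := exists_simulate_of_macrostep htr y.2.2
        obtain ⟨q', x', b', hq', hy', htau⟩ := exists_taus_guess hq hy he
        refine ⟨(q', x'), (.simulate, y.1, y.2.1, e), htau,
          Or.inl ⟨b', hy', .hash q' b' hq'⟩, .inp s q' x' (y.1, y.2.1, e) b' hq' hy' hs, ?_⟩
        rcases hres with ⟨r, hr, rfl, hts⟩ | ⟨hdom, rfl, hts⟩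
        · exact .out t .simulate _ (r.1, r.2, 0) true id (Part.mem_map _ hr) hts
        · exact .div t .simulate _ hdom hts
    | out s q x y b hq hy hs =>
      obtain ⟨w, wo, e⟩ := y
      cases ht with
      | send _ d wo =>
        exact ⟨(.out (some d), w, d :: wo, e), (.pop, w, d :: wo, e), taus_out hq hy rfl,
          Or.inl ⟨true, by simp [ctlProgram], .send d⟩, CtlRel.out' hs _ _ _,
          CtlRel.pop hs _ _ _⟩
      | finish =>
        exact ⟨(.out none, w, [], e), (.next, w, [], e), taus_out hq hy rfl,
          Or.inl ⟨true, by simp [ctlProgram], .finish⟩, CtlRel.out' hs _ _ _,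
          CtlRel.next hs _ _⟩
    | div s q x hq hs =>
      cases ht with
      | diverge =>
        -- The program has no transition here; the `τ`-loop is matched by doing nothing.
        exact ⟨(q, x), (q, x), ReflTransGen.refl, Or.inr ⟨rfl, rfl⟩, .div s q x hq hs,
          .div s q x hq hs⟩
  step_right := by
    rintro s₁ ⟨q, x⟩ h a ⟨q', y'⟩ ⟨b', hy', ho⟩
    cases h with
    | inp s _ _ y b hq hy hs =>
      obtain ⟨rfl, rfl⟩ := Prod.ext_iff.1 (Part.mem_unique hy' hy)
      have hrel : M.CtlRel (.inp s y'.2.1) (q, x) := .inp s q x y' b' hq hy hs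
      cases ho with
      | recv _ _ d =>
        exact ⟨_, _, ReflTransGen.refl, Or.inl (.recv s _ d), hrel, CtlRel.recv hs _ _ _⟩
      | next =>
        exact ⟨_, _, ReflTransGen.refl, Or.inr ⟨rfl, rfl⟩, hrel, CtlRel.next hs _ _⟩
      | hash =>
        -- The guess is now fixed, so whether the simulation is defined decides which macrostep
        -- answers. The target is reachable because `s` is.
        by_cases hdom : (M.simulate y').Dom
        · obtain ⟨r, hr⟩ := Part.dom_iff_mem.1 hdom
          have hm := macrostep_of_mem_simulate hr
          rw [← hs] at hm
          let t : M.toITS.State := ⟨.word r.1, s.2.tail ⟨_, _, hm⟩⟩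
          exact ⟨_, .out t (.word r.2), ReflTransGen.refl, Or.inl (.macrostep s _ _ t hm), hrel,
            .out t .simulate y' (r.1, r.2, 0) true id (Part.mem_map _ hr) rfl⟩
        · have hm := macrostep_of_not_simulate_dom hdom
          rw [← hs] at hm
          let t : M.toITS.State := ⟨.infinity, s.2.tail ⟨_, _, hm⟩⟩
          exact ⟨_, .out t .mu, ReflTransGen.refl, Or.inl (.macrostep s _ _ t hm), hrel,
            .div t .simulate y' hdom rfl⟩
      | simulate => cases hq
      | pop => cases hq
      | retry => cases hq
      | send => cases hq
      | finish => cases hq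
    | out s _ _ y b hq hy hs =>
      obtain ⟨rfl, rfl⟩ := Prod.ext_iff.1 (Part.mem_unique hy' hy)
      have hrel : M.CtlRel (.out s (.word y'.2.1)) (q, x) := .out s q x y' b' hq hy hs
      cases ho with
      | recv _ _ _ hq' => exact absurd hq' hq
      | hash _ _ hq' => exact absurd hq' hq
      | next _ _ hq' => exact absurd hq' hq
      | simulate =>
        exact ⟨_, _, ReflTransGen.refl, Or.inr ⟨rfl, rfl⟩, hrel, CtlRel.out' hs _ _ _⟩
      | pop =>
        exact ⟨_, _, ReflTransGen.refl, Or.inr ⟨rfl, rfl⟩, hrel, CtlRel.out' hs _ _ _⟩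
      | retry =>
        exact ⟨_, _, ReflTransGen.refl, Or.inr ⟨rfl, rfl⟩, hrel, CtlRel.out' hs _ _ _⟩
      | send d =>
        obtain ⟨rfl, hd⟩ := head?_eq_of_mem_run_out hy'
        obtain ⟨w, wo, e⟩ := y'
        obtain ⟨wo, rfl⟩ : ∃ l, wo = d :: l :=
          List.head?_eq_some_iff.1 hd
        exact ⟨_, .out s (.word wo), ReflTransGen.refl, Or.inl (.send s d wo), hrel,
          CtlRel.pop hs _ _ _⟩
      | finish =>
        obtain ⟨rfl, hd⟩ := head?_eq_of_mem_run_out hy'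
        obtain ⟨w, wo, e⟩ := y'
        obtain rfl : wo = [] := by simpa using hd
        exact ⟨_, .inp s [], ReflTransGen.refl, Or.inl (.finish s), hrel, CtlRel.next hs _ _⟩
    | div s _ _ hq hs => exact absurd (Part.dom_iff_mem.2 ⟨_, hy'⟩) hq
  final_left := by rintro _ _ _ ⟨⟩
  final_right := by rintro _ _ _ ⟨⟩

theorem branchingBisimilar_ctlLTS (M : PTM.{u, v} D) :
    LTS.BranchingBisimilar M.toLTS M.ctlLTS :=
  ⟨M.CtlRel, isBranchingBisimulation_ctlRel, CtlRel.next rfl [] 0⟩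

end PTM

/-! ### Choice of the auxiliary symbols and conclusion. -/

open Turing in
open scoped Classical in
/-- The symbols of a finite tape alphabet as non-blank symbols of a larger alphabet. -/
theorem exists_pointedMap {X : Type} [Inhabited X] (D : Type u) :
    ∃ (i : PointedMap X (Option (D ⊕ X))) (j : Option (D ⊕ X) → X), ∀ x, j (i x) = x := by
  refine ⟨⟨fun x => if x = default then none else some (.inr x), if_pos rfl⟩,
    fun y => y.elim default (Sum.elim (fun _ => default) id), fun x => ?_⟩
  change Option.elim (if x = default then none else some (.inr x)) default
    (Sum.elim (fun _ => default) id) = x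
  split_ifs with h
  · exact h.symm
  · rfl

theorem mainTheorem8 {D : Type u} [Finite D] :
    ∃ X : Type, Finite X ∧ ∀ M : PTM.{u, v} D, ∃ N : RTM (PortAction D) (D ⊕ X),
      LTS.BranchingBisimilar M.toLTS N.toLTS := by
  refine ⟨Turing.PartrecToTM2.TapeSymbol, inferInstance, fun M => ?_⟩
  let _ : Primcodable D := Primcodable.ofFinite D
  obtain ⟨i, j, hij⟩ := exists_pointedMap (X := Turing.PartrecToTM2.TapeSymbol) D
  obtain ⟨N, hN⟩ := M.ctlProgram.exists_rtm M.partrec_ctlProgram .next ([], [], 0)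
    -- The initial data have code zero, which is the number that the machine sets up on the blank
    -- tape.
    (by simp [Encodable.encode_prod_val, Nat.pair]) i j hij
  exact ⟨N, M.branchingBisimilar_ctlLTS.trans hN⟩
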